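/- Let $\alpha_0>\alpha_1>0$. A \emph{Poisson simple random walk} of rate $r$ started from $0$ is the counting function of a rate-$r$ Poisson point process on $(0,\infty)$: a $\mathbb{Z}$-valued process $X(t)$, $t\ge 0$, which almost surely starts from $0$ and has right-continuous nondecreasing step trajectories with jumps of size $1$, and which has independent increments $X(t)-X(s)\sim\mathrm{Poisson}(r(t-s))$, $s\le t$. Let $y_1(t)$, $t\ge0$, be a Poisson simple random walk of rate $\alpha_1$ started from $0$. Given the trajectory of $y_1$, let $x_1(t)$, $t\ge 0$, be the walk on $\mathbb{Z}$ started from $x_1(0)=0$ in the chamber $x_1(t)\ge y_1(t)$ which jumps up by $1$ at rate $\alpha_0$ if $x_1(t)>y_1(t)$ and at rate $\alpha_0-\alpha_1$ if $x_1(t)=y_1(t)$, and which is deterministically pushed up by $1$ when $y_1$ jumps up by $1$ while $x_1=y_1$. In detail: almost surely the trajectory of $x_1$ starts from $0$, is a right-continuous nondecreasing step function with jumps of size $1$, and satisfies $x_1\ge y_1$; and for all $0\le t\le u$, conditionally on the whole trajectory of $y_1$ and on $(x_1(s))_{s\le t}$, the probability that $x_1$ makes no jump other than pushes during $(t,u]$,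 that is, that $x_1(s)=\max(x_1(t),y_1(s))$ for all $s\in(t,u]$, equals $$\exp\Big(-\int_t^u \big(\alpha_0-\alpha_1\mathbf 1\{\max(x_1(t),y_1(s))=y_1(s)\}\big)\,ds\Big).$$ Then $x_1(t)$, $t\ge0$, is a Poisson simple random walk of rate $\alpha_0$ started from $0$. -/

import Mathlib

open MeasureTheory ProbabilityTheory Set Filter Topology
open scoped NNReal

/-- Trajectories of a walk on `ℤ` started at `0` and going up by unit steps: right-continuous
nondecreasing step functions on `[0, ∞)` all of whose jumps have size `1`. -/
structure IsUnitStepPath (f : ℝ≥0 → ℤ) : Prop where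
  zero : f 0 = 0
  mono : Monotone f
  rightCts : ∀ t, ∀ᶠ s in 𝓝[>] t, f s = f t
  unitJump : ∀ t, ∀ᶠ s in 𝓝[<] t, f t ≤ f s + 1

/-- `X` is a continuous time Poisson simple random walk of rate `r` started from `0`, that is,
the counting function of a Poisson point process of rate `r` on `(0, ∞)`. -/
structure IsPoissonWalk {Ω : Type*} [MeasurableSpace Ω] (r : ℝ≥0) (X : ℝ≥0 → Ω → ℤ)
    (P : Measure Ω) : Prop where
  measurable : ∀ t, Measurable (X t)
  path : ∀ᵐ ω ∂P, IsUnitStepPath (fun t => X t ω)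
  indep : HasIndepIncrements X P
  law : ∀ s t, s ≤ t →
    HasLaw (fun ω => X t ω - X s ω) ((poissonMeasure (r * (t - s))).map (fun n : ℕ => (n : ℤ))) P

/-- The rate of the clock of the upper walk at position `a`, when the bottom boundary of the
chamber is at `b`: it is `α₀` in the bulk and `α₀ - α₁` on the boundary. -/
noncomputable def chamberRate (α₀ α₁ : ℝ≥0) (a b : ℤ) : ℝ :=
  if a = b then (α₀ : ℝ) - α₁ else α₀

/-- The information about the whole trajectory of `Y` and about `X` up to time `t`. -/
@[reducible] def chamberInfo {Ω : Type*} (X Y : ℝ≥0 → Ω → ℤ) (t : ℝ≥0) : MeasurableSpace Ω :=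
  (⨆ s : ℝ≥0, MeasurableSpace.comap (Y s) inferInstance) ⊔
    ⨆ s : Iic t, MeasurableSpace.comap (X s) inferInstance

/-- The event that `X` makes no jump of its own during `(t, u]`: throughout this time interval
it stays at its position at time `t`, except for being pushed up by `Y`. -/
def noOwnJump {Ω : Type*} (X Y : ℝ≥0 → Ω → ℤ) (t u : ℝ≥0) : Set Ω :=
  {ω | ∀ s ∈ Ioc t u, X s ω = max (X t ω) (Y s ω)}

/-- Given the trajectory of `Y`, the process `X` is the random walk started from `0` in the
chamber `X ≥ Y` that jumps up by `1` at rate `α₀` if `X > Y` and at rate `α₀ - α₁` if `X = Y`,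
and that is pushed up by `Y` when `Y` jumps while `X = Y`.

The jump rates are those of an exponential clock with a time-dependent rate: given the
trajectory of `Y` and the past of `X` up to time `t`, the clock does not ring during `(t, u]` with
probability `exp (-∫ₜᵘ rate)`. As long as the clock has not rung after time `t`, the walk is at
`max (X t) (Y s)` at time `s`, so that the current rate is the one at this position.
The chamber condition `X ≥ Y` is what pushes `X`. -/
structure IsChamberWalk {Ω : Type*} [MeasurableSpace Ω] (α₀ α₁ : ℝ≥0) (X Y : ℝ≥0 → Ω → ℤ)
    (P : Measure Ω) : Prop where
  measurable : ∀ t, Measurable (X t)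
  path : ∀ᵐ ω ∂P, IsUnitStepPath (fun t => X t ω)
  chamber : ∀ᵐ ω ∂P, ∀ t, Y t ω ≤ X t ω
  clock : ∀ t u, t ≤ u →
    P[(noOwnJump X Y t u).indicator (fun _ => (1 : ℝ)) | chamberInfo X Y t] =ᵐ[P]
      fun ω => Real.exp (-∫ s in (t : ℝ)..u,
        chamberRate α₀ α₁ (max (X t ω) (Y s.toNNReal ω)) (Y s.toNNReal ω))

/-! ### Local structure of unit step paths. -/

section Paths

/-! It suffices to show that `x` stays put during `(t, u]` with probability `exp (-α₀ (u - t))`,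
independently of its past: a unit step process with such memoryless waiting times is a Poisson walk
(`isPoissonWalk_of_stay_indep`).

Let `x t = a`, `y t = b` and `q = a - b`. Then `x` stays put exactly when its own clock is silent
and `y u ≤ a`. Given all of `y` and the past of `x`, this has probability `exp (-α₀ (u - t)) * exp
(α₁ L) * 1{y u ≤ a}`, where `L` is the time `y` spends at `a`. The slower rate at the wall
compensates exactly for the pushes, because the weight `exp (α₁ L) * 1{y u ≤ a}` has mean `1` for
every `q ≥ 0` (`IsPoissonWalk.integral_exp_occupation`). Indeed the weight equals `1{y u ≤ a}` plus
the integral over `s` of `α₁ exp (α₁ (u - s)) * 1{y s = y u = a}`. The exponential cancels the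
probability of no jump of `y` between `s` and `u`, and what remains integrates to the probability
that `y` exceeds `a` by time `u`.

To average the weight given the past of both walks, the future increments of `y` must be independent
of that past. This is not given directly, since the clock is described conditionally on the whole
trajectory of `y`. It holds because the clock rates up to time `t` only involve `y` up to time `t`.
`IsChamberWalk.integral_mul_eq_zero` makes this rigorous by comparing `x` on a fine time grid with a
chain making at most one own jump per cell. The comparison fails only in bad cells, and their
expected number below a height cutoff tends to `0` with the mesh. -/

lemma IsUnitStepPath.exists_local {f : ℝ≥0 → ℤ} (hf : IsUnitStepPath f) (c : ℝ≥0) :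
    ∃ ε > 0, (∀ r r', dist r c < ε → r < c → dist r' c < ε → r' < c → f r = f r') ∧
      (∀ r, dist r c < ε → c ≤ r → f r = f c) ∧ (∀ r, dist r c < ε → r < c → f c ≤ f r + 1) := by
  have hR := hf.rightCts c
  rw [eventually_nhdsWithin_iff, Metric.eventually_nhds_iff] at hR
  obtain ⟨ε₁, h₁, hR⟩ := hR
  have hJ := hf.unitJump c
  rw [eventually_nhdsWithin_iff, Metric.eventually_nhds_iff] at hJ
  obtain ⟨ε₂, h₂, hJ⟩ := hJ
  have hL : ∃ ε₃ > 0, ∀ r r', dist r c < ε₃ → r < c → dist r' c < ε₃ → r' < c → f r = f r' := by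
    -- Constancy to the left of `c` is not assumed. Either the value `f c` is already taken earlier,
    -- and monotonicity propagates it, or the jump bound and integrality force the value `f c - 1`
    -- near `c`.
    by_cases h : ∃ s < c, f s = f c
    · obtain ⟨s, hs, hsc⟩ := h
      refine ⟨dist s c, dist_pos.2 hs.ne, ?_⟩
      have key : ∀ r, dist r c < dist s c → r < c → f r = f c := by
        intro r hr hrc
        have hsr : s ≤ r := by
          have hs' : (s : ℝ) < c := hs
          have hr' : (r : ℝ) < c := hrc
          rw [NNReal.dist_eq, NNReal.dist_eq, abs_sub_comm, abs_of_pos (by linarith),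
            abs_sub_comm, abs_of_pos (by linarith)] at hr
          have : (s : ℝ) ≤ r := by linarith
          exact_mod_cast this
        exact le_antisymm (hf.mono hrc.le) (hsc ▸ hf.mono hsr)
      intro r r' h1 h2 h3 h4
      rw [key r h1 h2, key r' h3 h4]
    · push Not at h
      refine ⟨ε₂, h₂, ?_⟩
      have key : ∀ r, dist r c < ε₂ → r < c → f r = f c - 1 := by
        intro r hr hrc
        have h1 := hJ hr hrc
        have h2 := h r hrc
        have h3 := hf.mono hrc.le
        omega
      intro r r' h1 h2 h3 h4
      rw [key r h1 h2, key r' h3 h4]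
  obtain ⟨ε₃, h₃, hL⟩ := hL
  refine ⟨min ε₁ (min ε₂ ε₃), by positivity, ?_, ?_, ?_⟩
  · intro r r' h1 h2 h3 h4
    exact hL r r' (lt_of_lt_of_le h1 (by simp)) h2 (lt_of_lt_of_le h3 (by simp)) h4
  · intro r h1 h2
    rcases h2.eq_or_lt with rfl | h2
    · rfl
    · exact hR (lt_of_lt_of_le h1 (by simp)) h2
  · intro r h1 h2
    exact hJ (lt_of_lt_of_le h1 (by simp)) h2

/-- On sufficiently short time intervals, two unit step paths have at most one common jump time. -/
lemma IsUnitStepPath.exists_mesh {f g : ℝ≥0 → ℤ} (hf : IsUnitStepPath f) (hg : IsUnitStepPath g)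
    (T : ℝ≥0) : ∃ δ > 0, ∀ a b : ℝ≥0, a ≤ b → b ≤ T → (b : ℝ) - a < δ →
      f b ≤ f a + 1 ∧ ∃ c, (∀ r, a ≤ r → r ≤ b → r < c → f r = f a ∧ g r = g a) ∧
        (∀ r, a ≤ r → r ≤ b → c ≤ r → f r = f b ∧ g r = g b) := by
  choose ε₁ h₁ hL₁ hR₁ hJ₁ using hf.exists_local
  choose ε₂ h₂ hL₂ hR₂ _ using hg.exists_local
  -- Inside the ball around `c` both paths can change only at `c`. A Lebesgue number of this cover
  -- puts each short interval in one ball, whose centre is the sought time, possibly outside the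
  -- interval.
  obtain ⟨δ, hδ, H⟩ := lebesgue_number_lemma_of_metric (s := Icc 0 T) (ι := ℝ≥0)
    (c := fun c => Metric.ball c (min (ε₁ c) (ε₂ c))) isCompact_Icc
    (fun _ => Metric.isOpen_ball)
    (fun x _ => mem_iUnion.2 ⟨x, Metric.mem_ball_self (lt_min (h₁ x) (h₂ x))⟩)
  refine ⟨δ, hδ, fun a b hab hbT hd => ?_⟩
  obtain ⟨c, hc⟩ := H b ⟨zero_le, hbT⟩
  have near : ∀ r, a ≤ r → r ≤ b → dist r c < ε₁ c ∧ dist r c < ε₂ c := by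
    intro r har hrb
    have : r ∈ Metric.ball b δ := by
      have h1 : (a : ℝ) ≤ r := har
      have h2 : (r : ℝ) ≤ b := hrb
      rw [Metric.mem_ball, NNReal.dist_eq, abs_sub_comm, abs_of_nonneg (by linarith)]
      linarith
    have := hc this
    rw [Metric.mem_ball] at this
    exact lt_min_iff.1 this
  have na := near a le_rfl hab
  have nb := near b hab le_rfl
  constructor
  · rcases lt_or_ge b c with hbc | hcb
    · rw [hL₁ c a b na.1 (hab.trans_lt hbc) nb.1 hbc]; omega
    · rcases lt_or_ge a c with hac | hca
      · rw [hR₁ c b nb.1 hcb]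
        exact hJ₁ c a na.1 hac
      · rw [hR₁ c b nb.1 hcb, hR₁ c a na.1 hca]; omega
  · refine ⟨c, fun r har hrb hrc => ?_, fun r har hrb hcr => ?_⟩
    · have n := near r har hrb
      exact ⟨hL₁ c r a n.1 hrc na.1 (har.trans_lt hrc), hL₂ c r a n.2 hrc na.2 (har.trans_lt hrc)⟩
    · have n := near r har hrb
      exact ⟨(hR₁ c r n.1 hcr).trans (hR₁ c b nb.1 (hcr.trans hrb)).symm,
        (hR₂ c r n.2 hcr).trans (hR₂ c b nb.2 (hcr.trans hrb)).symm⟩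

/-! ### Time discretization and measurability of time integrals. -/

/-- A discretization of the time `s ∈ [t, u]` from above, with mesh `1 / (n + 1)`. -/
noncomputable def upperTime (t u : ℝ≥0) (n k : ℕ) : ℝ≥0 := max t (min u (k / (n + 1)))

/-- The index of the discretized time above `s`. -/
noncomputable def upperIndex (n : ℕ) (s : ℝ≥0) : ℕ := ⌈(n + 1) * s⌉₊

lemma upperTime_mem {t u : ℝ≥0} (htu : t ≤ u) (n k : ℕ) : upperTime t u n k ∈ Icc t u :=
  ⟨le_max_left _ _, max_le htu (min_le_left _ _)⟩

/-- The discretized times converge to `s` without going below it, so right-continuity of an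
integer-valued path makes its value exact from some index on. -/
lemma eventually_upperTime_eq {f : ℝ≥0 → ℤ} {t u s : ℝ≥0} (hf : ∀ᶠ r in 𝓝[>] s, f r = f s)
    (hs : s ∈ Icc t u) :
    ∀ᶠ n : ℕ in atTop, f (upperTime t u n (upperIndex n s)) = f s := by
  have hf' : ∀ᶠ r in 𝓝[≥] s, f r = f s := by
    rw [← Ioi_insert, nhdsWithin_insert]
    exact Filter.mem_sup.2 ⟨by simp, hf⟩
  have hlow : ∀ n : ℕ, s ≤ upperTime t u n (upperIndex n s) := by
    intro n
    refine le_max_of_le_right (le_min hs.2 ?_)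
    rw [le_div_iff₀ (by positivity), mul_comm]
    exact Nat.le_ceil _
  have hup : ∀ n : ℕ, upperTime t u n (upperIndex n s) ≤ s + 1 / (n + 1) := by
    intro n
    refine max_le (hs.1.trans (by simp)) (min_le_of_right_le ?_)
    have e : (s + 1 / ((n : ℝ≥0) + 1)) * (n + 1) = (n + 1) * s + 1 := by field_simp
    rw [div_le_iff₀ (by positivity), e]
    exact (Nat.ceil_lt_add_one (by positivity)).le
  have hlim : Tendsto (fun n : ℕ => upperTime t u n (upperIndex n s)) atTop (𝓝 s) := by
    refine tendsto_of_tendsto_of_tendsto_of_le_of_le tendsto_const_nhds ?_ hlow hup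
    have : Tendsto (fun n : ℕ => 1 / ((n : ℝ≥0) + 1)) atTop (𝓝 0) :=
      tendsto_one_div_add_atTop_nhds_zero_nat
    simpa using this.const_add s
  exact (tendsto_nhdsWithin_iff.2 ⟨hlim, .of_forall hlow⟩).eventually hf'

lemma measurable_upperIndex (n : ℕ) : Measurable (upperIndex n) :=
  Nat.measurable_ceil.comp (measurable_const_mul _)

lemma measurable_comp_index {Ω : Type*} {m : MeasurableSpace Ω} {W : ℕ → Ω → ℤ}
    (hW : ∀ k, Measurable (W k)) {i : ℝ → ℕ} (hi : Measurable i) :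
    Measurable (fun q : ℝ × Ω => W (i q.1) q.2) := by
  have h : Measurable (fun q : ℕ × Ω => W q.1 q.2) :=
    measurable_from_prod_countable_right hW
  exact h.comp (Measurable.prodMk (hi.comp measurable_fst) measurable_snd)

lemma measurable_upperTime_process {Ω : Type*} {m : MeasurableSpace Ω} {Z : ℝ≥0 → Ω → ℤ}
    {t u : ℝ≥0} (htu : t ≤ u) (hZ : ∀ s ∈ Icc t u, Measurable (Z s)) (n : ℕ) :
    Measurable (fun q : ℝ × Ω => Z (upperTime t u n (upperIndex n q.1.toNNReal)) q.2) :=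
  measurable_comp_index (W := fun k => Z (upperTime t u n k))
    (i := fun s => upperIndex n s.toNNReal) (fun k => hZ _ (upperTime_mem htu n k))
    ((measurable_upperIndex n).comp measurable_real_toNNReal)

/-- Joint measurability for Fubini: the process is an a.e. limit of its discretizations, each of
which reads only countably many coordinates. -/
lemma aestronglyMeasurable_prod_of_rightCts {Ω : Type*} [MeasurableSpace Ω] {P : Measure Ω}
    [SFinite P] {Z : ℝ≥0 → Ω → ℤ} {t u : ℝ≥0} (htu : t ≤ u)
    (hZ : ∀ s ∈ Icc t u, Measurable (Z s))
    (hr : ∀ᵐ ω ∂P, ∀ s, ∀ᶠ r in 𝓝[>] s, Z r ω = Z s ω) (h : ℤ → ℝ) :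
    AEStronglyMeasurable (fun q : ℝ × Ω => h (Z q.1.toNNReal q.2))
      ((volume.restrict (Ioc (t : ℝ) u)).prod P) := by
  refine aestronglyMeasurable_of_tendsto_ae atTop
    (f := fun (n : ℕ) (q : ℝ × Ω) =>
      h (Z (upperTime t u n (upperIndex n q.1.toNNReal)) q.2))
    (fun n => ((measurable_of_countable h).comp
      (measurable_upperTime_process htu hZ n)).aestronglyMeasurable) ?_
  have h1 : ∀ᵐ q : ℝ × Ω ∂((volume.restrict (Ioc (t : ℝ) u)).prod P), q.1 ∈ Ioc (t : ℝ) u :=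
    Measure.quasiMeasurePreserving_fst.ae (ae_restrict_mem measurableSet_Ioc)
  have h2 : ∀ᵐ q : ℝ × Ω ∂((volume.restrict (Ioc (t : ℝ) u)).prod P),
      ∀ s, ∀ᶠ r in 𝓝[>] s, Z r q.2 = Z s q.2 := Measure.quasiMeasurePreserving_snd.ae hr
  filter_upwards [h1, h2] with q hq1 hq2
  refine tendsto_nhds_of_eventually_eq ?_
  have hmem : q.1.toNNReal ∈ Icc t u :=
    ⟨NNReal.le_toNNReal_of_coe_le hq1.1.le, Real.toNNReal_le_iff_le_coe.2 hq1.2⟩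
  filter_upwards [eventually_upperTime_eq (f := fun r => Z r q.2) (hq2 _) hmem] with n hn
  rw [hn]

lemma stronglyMeasurable_limUnder_seq {Ω : Type*} {m : MeasurableSpace Ω} {f : ℕ → Ω → ℝ}
    (hf : ∀ n, StronglyMeasurable (f n)) :
    StronglyMeasurable (fun ω => limUnder atTop (fun n => f n ω)) :=
  StronglyMeasurable.limUnder hf

/-- The σ-algebra `m` need not contain the null sets of `P`. The everywhere defined `limUnder` is
`m`-measurable and serves as a version of the limit. -/
lemma aestronglyMeasurable_of_tendsto_ae_sub {Ω : Type*} {m mΩ : MeasurableSpace Ω}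
    {P : Measure[mΩ] Ω} {f : ℕ → Ω → ℝ} {g : Ω → ℝ} (hf : ∀ n, StronglyMeasurable[m] (f n))
    (h : ∀ᵐ ω ∂P, Tendsto (fun n => f n ω) atTop (𝓝 (g ω))) : AEStronglyMeasurable[m] g P := by
  refine ⟨_, stronglyMeasurable_limUnder_seq hf, ?_⟩
  filter_upwards [h] with ω hω using hω.limUnder_eq.symm

/-- The integral over `(t, u]` is known from the values of `Z` on `[t, u]` alone. This lets
functionals of `y` be attributed to its past or to its future. -/
lemma aestronglyMeasurable_intervalIntegral_of_rightCts {Ω : Type*} {m mΩ : MeasurableSpace Ω}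
    {P : Measure[mΩ] Ω} {Z : ℝ≥0 → Ω → ℤ} {t u : ℝ≥0} (htu : t ≤ u)
    (hZ : ∀ s ∈ Icc t u, Measurable[m] (Z s))
    (hr : ∀ᵐ ω ∂P, ∀ s, ∀ᶠ r in 𝓝[>] s, Z r ω = Z s ω) {h : ℤ → ℝ} {C : ℝ} (hC : ∀ k, ‖h k‖ ≤ C) :
    AEStronglyMeasurable[m] (fun ω => ∫ s in (t : ℝ)..u, h (Z s.toNNReal ω)) P := by
  have htu' : (t : ℝ) ≤ u := htu
  have hm : ∀ n : ℕ, Measurable[(inferInstance : MeasurableSpace ℝ).prod m] (fun q : ℝ × Ω =>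
      h (Z (upperTime t u n (upperIndex n q.1.toNNReal)) q.2)) := fun n =>
    (measurable_of_countable h).comp (measurable_upperTime_process (m := m) htu hZ n)
  refine aestronglyMeasurable_of_tendsto_ae_sub
    (f := fun n ω => ∫ s in (t : ℝ)..u,
      h (Z (upperTime t u n (upperIndex n s.toNNReal)) ω)) (fun n => ?_) ?_
  · simp_rw [intervalIntegral.integral_of_le htu']
    exact @StronglyMeasurable.integral_prod_left' ℝ Ω ℝ _ m _ _ _ _ _
      ((hm n).stronglyMeasurable)
  · filter_upwards [hr] with ω hω
    refine intervalIntegral.tendsto_integral_filter_of_dominated_convergence (fun _ => C)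
      (.of_forall fun n => ?_) (.of_forall fun n => .of_forall fun s _ => hC _)
      intervalIntegrable_const (.of_forall fun s hs => ?_)
    · exact ((hm n).comp (@measurable_prodMk_right ℝ Ω _ m ω)).aestronglyMeasurable
    · rw [uIoc_of_le htu'] at hs
      have hmem : s.toNNReal ∈ Icc t u :=
        ⟨NNReal.le_toNNReal_of_coe_le hs.1.le, Real.toNNReal_le_iff_le_coe.2 hs.2⟩
      refine tendsto_nhds_of_eventually_eq ?_
      filter_upwards [eventually_upperTime_eq (f := fun r => Z r ω) (hω _) hmem] with n hn
      rw [hn]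

end Paths

/-! ### Independence of past and future increments. -/

section Increments

/-- The increasing enumeration, prolonged by its last value, turns a finite set of times into a
sequence to which independence of successive increments applies. -/
lemma exists_monotone_range_eq_finset {α : Type*} [LinearOrder α] (A : Finset α)
    (hA : A.Nonempty) : ∃ τ : ℕ → α, Monotone τ ∧ range τ = A := by
  have hc : 0 < A.card := hA.card_pos
  refine ⟨fun i => A.orderEmbOfFin rfl ⟨min i (A.card - 1), by omega⟩, fun i j hij => ?_, ?_⟩
  · refine (A.orderEmbOfFin rfl).monotone ?_
    rw [Fin.mk_le_mk]
    omega
  · rw [← A.range_orderEmbOfFin rfl]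
    ext a
    constructor
    · rintro ⟨i, rfl⟩
      exact mem_range_self _
    · rintro ⟨i, rfl⟩
      have := i.2
      exact ⟨i, congrArg (A.orderEmbOfFin rfl) (Fin.ext (by simp only; omega))⟩

variable {Ω : Type*}

/-- The information about the increments of `Y` up to time `T`. -/
@[reducible] def pastInc (Y : ℝ≥0 → Ω → ℤ) (T : ℝ≥0) : MeasurableSpace Ω :=
  ⨆ s : Iic T, MeasurableSpace.comap (fun ω => Y s ω - Y 0 ω) inferInstance

/-- The information about the increments of `Y` after time `T`. -/
@[reducible] def futureInc (Y : ℝ≥0 → Ω → ℤ) (T : ℝ≥0) : MeasurableSpace Ω :=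
  ⨆ s : Ici T, MeasurableSpace.comap (fun ω => Y s ω - Y T ω) inferInstance

lemma measurable_pastInc (Y : ℝ≥0 → Ω → ℤ) {s T : ℝ≥0} (h : s ≤ T) :
    Measurable[pastInc Y T] (fun ω => Y s ω - Y 0 ω) :=
  Measurable.of_comap_le
    (le_iSup (fun s : Iic T => MeasurableSpace.comap (fun ω => Y s ω - Y 0 ω) inferInstance) ⟨s, h⟩)

lemma measurable_futureInc (Y : ℝ≥0 → Ω → ℤ) {s T : ℝ≥0} (h : T ≤ s) :
    Measurable[futureInc Y T] (fun ω => Y s ω - Y T ω) :=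
  Measurable.of_comap_le
    (le_iSup (fun s : Ici T => MeasurableSpace.comap (fun ω => Y s ω - Y T ω) inferInstance) ⟨s, h⟩)

lemma pastInc_le {m : MeasurableSpace Ω} {Y : ℝ≥0 → Ω → ℤ} (hY : ∀ s, Measurable (Y s)) (T : ℝ≥0) :
    pastInc Y T ≤ m :=
  iSup_le fun s => ((hY s).sub (hY 0)).comap_le

lemma futureInc_le {m : MeasurableSpace Ω} {Y : ℝ≥0 → Ω → ℤ} (hY : ∀ s, Measurable (Y s))
    (T : ℝ≥0) : futureInc Y T ≤ m :=
  iSup_le fun s => ((hY s).sub (hY T)).comap_le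

lemma measurable_finset_iSup_comap {ι β : Type*} [MeasurableSpace β] {f : ι → Ω → β} {S : Set ι}
    {i : ι} (hi : i ∈ S) :
    Measurable[⨆ j ∈ S, MeasurableSpace.comap (f j) inferInstance] (f i) :=
  Measurable.of_comap_le (le_iSup₂ (f := fun j (_ : j ∈ S) => MeasurableSpace.comap (f j) _) i hi)

lemma directed_finset_iSup {ι : Type*} (m : ι → MeasurableSpace Ω) :
    Directed (· ≤ ·) (fun S : Finset ι => ⨆ s ∈ S, m s) := by
  classical
  exact directed_of_isDirected_le fun S S' h => biSup_mono fun s hs => Finset.mem_of_subset h hs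

variable [MeasurableSpace Ω] {P : Measure Ω} {Y : ℝ≥0 → Ω → ℤ}

/-- All times, together with `0` and `T`, are merged into one sequence. Past and future increments
are then telescoping sums over disjoint blocks of independent steps. -/
lemma ProbabilityTheory.HasIndepIncrements.indep_finset (hY : HasIndepIncrements Y P)
    (hm : ∀ s, Measurable (Y s)) {T : ℝ≥0} (S₁ : Finset (Ici T)) (S₂ : Finset (Iic T)) :
    Indep (⨆ s ∈ S₁, MeasurableSpace.comap (fun ω => Y s ω - Y T ω) inferInstance)
      (⨆ s ∈ S₂, MeasurableSpace.comap (fun ω => Y s ω - Y 0 ω) inferInstance) P := by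
  classical
  obtain ⟨τ, hτ, hr⟩ := exists_monotone_range_eq_finset
    ({0, T} ∪ (S₁.image Subtype.val ∪ S₂.image Subtype.val)) ⟨0, by simp⟩
  have h0 : τ 0 = 0 := by
    have : (0 : ℝ≥0) ∈ range τ := by rw [hr]; simp
    obtain ⟨i, hi⟩ := this
    exact le_antisymm (hi ▸ hτ (Nat.zero_le i)) zero_le
  obtain ⟨j, hj⟩ : T ∈ range τ := by rw [hr]; simp
  have hind := hY.nat hτ
  rw [iIndepFun_iff_iIndep] at hind
  have hdis : Disjoint {i | j ≤ i} {i | i < j} := by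
    rw [Set.disjoint_left]; intro i h1 h2; simp at h1 h2; omega
  have key := indep_iSup_of_disjoint
    (fun i => ((hm (τ (i + 1))).sub (hm (τ i))).comap_le) hind hdis
  refine indep_of_indep_of_le_left (indep_of_indep_of_le_right key ?_) ?_
  · refine iSup₂_le fun s hs => ?_
    obtain ⟨k, hk⟩ : (s : ℝ≥0) ∈ range τ := by
      rw [hr]; simp only [Finset.coe_union, Finset.coe_image]; exact .inr (.inr ⟨s, hs, rfl⟩)
    -- The sequence may repeat the value `T`; an index beyond `j` can then be replaced by `j`
    -- itself.
    obtain ⟨k, hkj, hk⟩ : ∃ k ≤ j, τ k = s := by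
      rcases le_total k j with h | h
      · exact ⟨k, h, hk⟩
      · exact ⟨j, le_rfl, le_antisymm (hk ▸ hτ h) (hj ▸ s.2)⟩
    refine Measurable.comap_le ?_
    have : (fun ω => Y s ω - Y 0 ω) =
        fun ω => ∑ i ∈ Finset.range k, (Y (τ (i + 1)) ω - Y (τ i) ω) := by
      ext ω
      rw [Finset.sum_range_sub (fun i => Y (τ i) ω), hk, h0]
    rw [this]
    refine Finset.measurable_fun_sum _ fun i hi => ?_
    have : i ∈ {i | i < j} := (Finset.mem_range.1 hi).trans_le hkj
    exact measurable_finset_iSup_comap (f := fun i ω => Y (τ (i + 1)) ω - Y (τ i) ω) this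
  · refine iSup₂_le fun s hs => ?_
    obtain ⟨k, hk⟩ : (s : ℝ≥0) ∈ range τ := by
      rw [hr]; simp only [Finset.coe_union, Finset.coe_image]; exact .inr (.inl ⟨s, hs, rfl⟩)
    obtain ⟨k, hkj, hk⟩ : ∃ k, j ≤ k ∧ τ k = s := by
      rcases le_total k j with h | h
      · exact ⟨j, le_rfl, le_antisymm (hj ▸ s.2) (hk ▸ hτ h)⟩
      · exact ⟨k, h, hk⟩
    refine Measurable.comap_le ?_
    have : (fun ω => Y s ω - Y T ω) =
        fun ω => ∑ i ∈ Finset.Ico j k, (Y (τ (i + 1)) ω - Y (τ i) ω) := by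
      ext ω
      rw [Finset.sum_Ico_sub (fun i => Y (τ i) ω) hkj, hk, hj]
    rw [this]
    refine Finset.measurable_fun_sum _ fun i hi => ?_
    have : i ∈ {i | j ≤ i} := (Finset.mem_Ico.1 hi).1
    exact measurable_finset_iSup_comap (f := fun i ω => Y (τ (i + 1)) ω - Y (τ i) ω) this

/-- The increments after time `T` are independent of the increments before time `T`. -/
lemma ProbabilityTheory.HasIndepIncrements.indep_futureInc_pastInc [IsProbabilityMeasure P]
    (hY : HasIndepIncrements Y P) (hm : ∀ s, Measurable (Y s)) (T : ℝ≥0) :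
    Indep (futureInc Y T) (pastInc Y T) P := by
  have hle₁ : ∀ S : Finset (Ici T),
      (⨆ s ∈ S, MeasurableSpace.comap (fun ω => Y s ω - Y T ω) inferInstance) ≤ ‹MeasurableSpace Ω› :=
    fun S => iSup₂_le fun s _ => ((hm s).sub (hm T)).comap_le
  have hle₂ : ∀ S : Finset (Iic T),
      (⨆ s ∈ S, MeasurableSpace.comap (fun ω => Y s ω - Y 0 ω) inferInstance) ≤ ‹MeasurableSpace Ω› :=
    fun S => iSup₂_le fun s _ => ((hm s).sub (hm 0)).comap_le
  rw [futureInc, pastInc, iSup_eq_iSup_finset, iSup_eq_iSup_finset (ι := Iic T)]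
  refine indep_iSup_of_directed_le (fun S₁ => ?_) hle₁ (iSup_le hle₂) (directed_finset_iSup _)
  exact (indep_iSup_of_directed_le (fun S₂ => (hY.indep_finset hm S₁ S₂).symm) hle₂ (hle₁ S₁)
    (directed_finset_iSup _)).symm

end Increments

/-! ### The clock of the upper walk. -/

section Clock

variable {Ω : Type*}

lemma measurable_comp_int {m : MeasurableSpace Ω} {W : ℤ → Ω → ℝ} (hW : ∀ k, Measurable (W k))
    {i : Ω → ℤ} (hi : Measurable i) : Measurable (fun ω => W (i ω) ω) := by
  have h : Measurable (fun q : ℤ × Ω => W q.1 q.2) := measurable_from_prod_countable_right hW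
  exact h.comp (hi.prodMk measurable_id)

/-- A function of the information in `m` and of `X` is a family of `m`-measurable functions indexed
by the value of `X`. The bound on `Φ` controls the factor only along the graph of `X`, hence the
truncation. -/
lemma exists_factor_int {m : MeasurableSpace Ω} {X : Ω → ℤ} {Φ : Ω → ℝ}
    (hΦ : Measurable[m ⊔ MeasurableSpace.comap X inferInstance] Φ) (hb : ∀ ω, |Φ ω| ≤ 1) :
    ∃ φ : ℤ → Ω → ℝ, (∀ k, Measurable (φ k)) ∧ (∀ k ω, |φ k ω| ≤ 1) ∧ ∀ ω, Φ ω = φ (X ω) ω := by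
  have e : MeasurableSpace.comap (fun ω => (id ω, X ω)) (MeasurableSpace.prod m inferInstance) =
      m ⊔ MeasurableSpace.comap X inferInstance :=
    (MeasurableSpace.comap_prodMk id X).trans (by rw [MeasurableSpace.comap_id])
  rw [← e] at hΦ
  obtain ⟨h, hm, rfl⟩ := hΦ.exists_eq_measurable_comp
  refine ⟨fun k ω => max (-1) (min 1 (h (ω, k))), fun k => ?_, fun k ω => ?_, fun ω => ?_⟩
  · exact measurable_const.max (measurable_const.min (hm.comp measurable_prodMk_right))
  · exact abs_le.2 ⟨le_max_left _ _, max_le (by norm_num) (min_le_left _ _)⟩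
  · have := abs_le.1 (hb ω)
    simp only [Function.comp_apply, id] at this ⊢
    rw [min_eq_right this.2, max_eq_right this.1]

/-- The probability that the clock of the upper walk at position `a` at time `t` does not ring
during `(t, u]`. -/
noncomputable def clockProb (α₀ α₁ : ℝ≥0) (Y : ℝ≥0 → Ω → ℤ) (t u : ℝ≥0) (a : ℤ) (ω : Ω) : ℝ :=
  Real.exp (-∫ s in (t : ℝ)..u,
    chamberRate α₀ α₁ (max a (Y s.toNNReal ω)) (Y s.toNNReal ω))

lemma chamberRate_nonneg {α₀ α₁ : ℝ≥0} (h : α₁ < α₀) (a b : ℤ) : 0 ≤ chamberRate α₀ α₁ a b := by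
  have : (α₁ : ℝ) < α₀ := h
  unfold chamberRate
  split_ifs
  · linarith
  · positivity

lemma clockProb_pos (α₀ α₁ : ℝ≥0) (Y : ℝ≥0 → Ω → ℤ) (t u : ℝ≥0) (a : ℤ) (ω : Ω) :
    0 < clockProb α₀ α₁ Y t u a ω := Real.exp_pos _

lemma clockProb_le_one {α₀ α₁ : ℝ≥0} (h : α₁ < α₀) (Y : ℝ≥0 → Ω → ℤ) {t u : ℝ≥0} (htu : t ≤ u)
    (a : ℤ) (ω : Ω) : clockProb α₀ α₁ Y t u a ω ≤ 1 := by
  rw [clockProb, Real.exp_le_one_iff, neg_nonpos]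
  exact intervalIntegral.integral_nonneg_of_forall (by exact_mod_cast htu)
    fun s => chamberRate_nonneg h _ _

lemma measurable_chamberInfo_left (X Y : ℝ≥0 → Ω → ℤ) (t s : ℝ≥0) :
    Measurable[chamberInfo X Y t] (Y s) :=
  Measurable.of_comap_le (le_sup_of_le_left
    (le_iSup (fun s => MeasurableSpace.comap (Y s) inferInstance) s))

lemma measurable_chamberInfo_right (X Y : ℝ≥0 → Ω → ℤ) {t s : ℝ≥0} (h : s ≤ t) :
    Measurable[chamberInfo X Y t] (X s) :=
  Measurable.of_comap_le (le_sup_of_le_right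
    (le_iSup (fun s : Iic t => MeasurableSpace.comap (X s) inferInstance) ⟨s, h⟩))

lemma chamberInfo_mono (X Y : ℝ≥0 → Ω → ℤ) {s t : ℝ≥0} (h : s ≤ t) :
    chamberInfo X Y s ≤ chamberInfo X Y t :=
  sup_le le_sup_left (iSup_le fun r =>
    (measurable_chamberInfo_right X Y (r.2.trans h)).comap_le)

lemma chamberInfo_le [m : MeasurableSpace Ω] {X Y : ℝ≥0 → Ω → ℤ} (hX : ∀ t, Measurable (X t))
    (hY : ∀ t, Measurable (Y t)) (t : ℝ≥0) : chamberInfo X Y t ≤ m :=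
  sup_le (iSup_le fun s => (hY s).comap_le) (iSup_le fun s => (hX s).comap_le)

lemma pastInc_le_chamberInfo (X Y : ℝ≥0 → Ω → ℤ) (T t : ℝ≥0) : pastInc Y T ≤ chamberInfo X Y t :=
  pastInc_le (measurable_chamberInfo_left X Y t) T

variable [MeasurableSpace Ω] {P : Measure Ω} {α₀ α₁ : ℝ≥0} {x y : ℝ≥0 → Ω → ℤ}

/-- For a fixed starting position the clock depends on `y` only up to time `u`: this is the
causality hidden in the rates. It holds up to null sets because `y 0 = 0` only almost surely. -/
lemma aestronglyMeasurable_clockProb {r : ℝ≥0} (hy : IsPoissonWalk r y P) {t u T : ℝ≥0}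
    (htu : t ≤ u) (huT : u ≤ T) (a : ℤ) :
    AEStronglyMeasurable[pastInc y T] (clockProb α₀ α₁ y t u a) P := by
  have h := aestronglyMeasurable_intervalIntegral_of_rightCts (m := pastInc y T) (P := P)
    (Z := fun s ω => y s ω - y 0 ω) htu
    (fun s hs => measurable_pastInc y (hs.2.trans huT)) ?_
    (h := fun k => chamberRate α₀ α₁ (max a k) k) (C := α₀ + α₁) ?_
  · have h2 := Real.continuous_exp.comp_aestronglyMeasurable h.neg
    refine h2.congr ?_
    filter_upwards [hy.path] with ω hω
    simp [clockProb, hω.zero]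
  · filter_upwards [hy.path] with ω hω s
    filter_upwards [hω.rightCts s] with r hr
    rw [hr]
  · intro k
    unfold chamberRate
    split_ifs
    · exact (norm_sub_le _ _).trans (by simp)
    · simp

variable [IsProbabilityMeasure P]

/-- The event involves uncountably many times and is not assumed measurable. Were its indicator not
integrable, its conditional expectation would be `0` by convention, whereas the clock gives a
positive exponential. -/
lemma IsChamberWalk.integrable_noOwnJump (hx : IsChamberWalk α₀ α₁ x y P) {t u : ℝ≥0}
    (htu : t ≤ u) : Integrable ((noOwnJump x y t u).indicator (fun _ => (1 : ℝ))) P := by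
  by_contra h
  have h1 := hx.clock t u htu
  rw [condExp_of_not_integrable h] at h1
  obtain ⟨ω, hω⟩ := h1.exists
  exact (Real.exp_pos _).ne hω

lemma IsChamberWalk.nullMeasurableSet_noOwnJump (hx : IsChamberWalk α₀ α₁ x y P) {t u : ℝ≥0}
    (htu : t ≤ u) : NullMeasurableSet (noOwnJump x y t u) P := by
  have h := (hx.integrable_noOwnJump htu).aestronglyMeasurable.aemeasurable
  exact (aemeasurable_indicator_const_iff (1 : ℝ)).1 h

lemma IsChamberWalk.integral_noOwnJump_mul (hx : IsChamberWalk α₀ α₁ x y P)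
    (hy : ∀ t, Measurable (y t)) {t u : ℝ≥0} (htu : t ≤ u) {Z : Ω → ℝ}
    (hZ : Measurable[chamberInfo x y t] Z) {C : ℝ} (hC : ∀ ω, |Z ω| ≤ C) :
    ∫ ω, (noOwnJump x y t u).indicator (fun _ => (1 : ℝ)) ω * Z ω ∂P =
      ∫ ω, clockProb α₀ α₁ y t u (x t ω) ω * Z ω ∂P := by
  have hle := chamberInfo_le hx.measurable hy t
  have h1 := condExp_stronglyMeasurable_mul_of_bound hle hZ.stronglyMeasurable
    (hx.integrable_noOwnJump htu) C (.of_forall hC)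
  have h2 := integral_condExp (μ := P) hle
    (f := Z * (noOwnJump x y t u).indicator (fun _ => (1 : ℝ)))
  calc _ = ∫ ω, (Z * (noOwnJump x y t u).indicator (fun _ => (1 : ℝ))) ω ∂P := by
        simp only [Pi.mul_apply, mul_comm]
    _ = _ := h2.symm
    _ = _ := by
        refine integral_congr_ae ?_
        filter_upwards [h1, hx.clock t u htu] with ω h1 h2
        rw [h1, Pi.mul_apply, h2, mul_comm]
        rfl

end Clock

/-! ### Comparison with a one-jump-per-cell chain. -/

section Causality

variable {Ω : Type*}

open Classical in
/-- The position at time `u` of a walk that makes at most one jump of its own during `(t, u]`,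
this jump being the last one. -/
noncomputable def chamberStep (X Y : ℝ≥0 → Ω → ℤ) (t u : ℝ≥0) (ω : Ω) : ℤ :=
  max (X t ω) (Y u ω) + if ω ∈ noOwnJump X Y t u then 0 else 1

/-- The event that the walk is not where `chamberStep` predicts. -/
def badPiece (X Y : ℝ≥0 → Ω → ℤ) (t u : ℝ≥0) : Set Ω := {ω | X u ω ≠ chamberStep X Y t u ω}

lemma notMem_badPiece_of_eq {X Y : ℝ≥0 → Ω → ℤ} {t u : ℝ≥0} {ω : Ω}
    (hX : Monotone (fun s => X s ω)) (hXY : ∀ s, Y s ω ≤ X s ω) (h : X u ω = X t ω) :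
    ω ∉ badPiece X Y t u := by
  have hc : ∀ s, t ≤ s → s ≤ u → X s ω = X t ω := fun s h1 h2 =>
    le_antisymm (h ▸ hX h2) (hX h1)
  have hN : ω ∈ noOwnJump X Y t u := fun s hs => by
    have := hXY s
    rw [hc s hs.1.le hs.2] at this ⊢
    rw [max_eq_left this]
  have := hXY u
  simp only [badPiece, chamberStep, hN, if_true, mem_ofPred_eq, not_not, add_zero]
  rw [h] at this ⊢
  rw [max_eq_left this]

/-- When both paths change only at `c`, a move of `x` is either a push or an own jump. If `y u`
exceeded `x t`, the unit move would be a push and `noOwnJump` would hold; so an own jump starts from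
the predicted height. -/
lemma notMem_badPiece_of_single {X Y : ℝ≥0 → Ω → ℤ} {t u : ℝ≥0} {ω : Ω} (htu : t ≤ u)
    (hX : Monotone (fun s => X s ω)) (hXY : ∀ s, Y s ω ≤ X s ω) (h1 : X u ω ≤ X t ω + 1) {c : ℝ≥0}
    (hl : ∀ r, t ≤ r → r ≤ u → r < c → X r ω = X t ω ∧ Y r ω = Y t ω)
    (hr : ∀ r, t ≤ r → r ≤ u → c ≤ r → X r ω = X u ω ∧ Y r ω = Y u ω) :
    ω ∉ badPiece X Y t u := by
  rcases (hX htu).eq_or_lt with h | h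
  · exact notMem_badPiece_of_eq hX hXY h.symm
  have hu : X u ω = X t ω + 1 := by simp only at h; omega
  have htu' : t < u := htu.lt_of_ne fun e => by simp [e] at hu
  have hYu := hXY u
  have hYt := hXY t
  by_cases hN : ω ∈ noOwnJump X Y t u
  · simp only [badPiece, chamberStep, hN, if_true, mem_ofPred_eq, not_not, add_zero]
    exact hN u ⟨htu', le_rfl⟩
  · simp only [badPiece, chamberStep, hN, if_false, mem_ofPred_eq, not_not]
    have : Y u ω ≤ X t ω := by
      by_contra hY
      refine hN fun s hs => ?_
      rcases lt_or_ge s c with hsc | hsc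
      · obtain ⟨e1, e2⟩ := hl s hs.1.le hs.2 hsc
        rw [e1, e2, max_eq_left hYt]
      · obtain ⟨e1, e2⟩ := hr s hs.1.le hs.2 hsc
        rw [e1, e2]
        omega
    rw [hu, max_eq_left this]

variable [MeasurableSpace Ω] {P : Measure Ω} [IsProbabilityMeasure P] {α₀ α₁ : ℝ≥0}
  {x y : ℝ≥0 → Ω → ℤ}

lemma IsChamberWalk.nullMeasurableSet_badPiece (hx : IsChamberWalk α₀ α₁ x y P)
    (hy : ∀ t, Measurable (y t)) {t u : ℝ≥0} (htu : t ≤ u) :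
    NullMeasurableSet (badPiece x y t u) P := by
  classical
  have h1 : AEMeasurable (fun ω => if ω ∈ noOwnJump x y t u then (0 : ℤ) else 1) P := by
    have := (aemeasurable_indicator_const_iff (1 : ℤ)).2 (hx.nullMeasurableSet_noOwnJump htu).compl
    refine this.congr (.of_forall fun ω => ?_)
    by_cases h : ω ∈ noOwnJump x y t u <;> simp [h]
  have h2 : AEMeasurable (chamberStep x y t u) P :=
    ((hx.measurable t).max (hy u)).aemeasurable.add h1
  exact (nullMeasurableSet_eq_fun (hx.measurable u).aemeasurable h2).compl

lemma ae_abs_le_integrable {f : Ω → ℝ} (hf : AEStronglyMeasurable f P) {C : ℝ}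
    (h : ∀ᵐ ω ∂P, |f ω| ≤ C) : Integrable f P :=
  Integrable.of_bound hf C h

lemma abs_mul_le_one {a b : ℝ} (ha : |a| ≤ 1) (hb : |b| ≤ 1) : |a * b| ≤ 1 := by
  rw [abs_mul]; exact mul_le_one₀ ha (abs_nonneg _) hb

lemma abs_ite_one_le (p : Prop) [Decidable p] : |if p then (1 : ℝ) else 0| ≤ 1 := by
  split_ifs <;> simp

lemma abs_convex_le {q a b : ℝ} (h0 : 0 ≤ q) (h1 : q ≤ 1) (ha : |a| ≤ 1) (hb : |b| ≤ 1) :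
    |q * a + (1 - q) * b| ≤ 1 := by
  rw [abs_le] at *
  constructor <;> nlinarith

/-- One step of the comparison of the chamber walk with a chain whose transition probabilities
only depend on `Y` up to time `T`. -/
lemma IsChamberWalk.exists_step {Ω : Type*} {H : MeasurableSpace Ω} [MeasurableSpace Ω]
    {P : Measure Ω} [IsProbabilityMeasure P] {α₀ α₁ : ℝ≥0} {x y : ℝ≥0 → Ω → ℤ}
    (hα : α₁ < α₀) {r : ℝ≥0} (hy : IsPoissonWalk r y P)
    (hx : IsChamberWalk α₀ α₁ x y P) {t u T : ℝ≥0} (htu : t ≤ u) (huT : u ≤ T) {v : Ω → ℝ}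
    (hv : Measurable[⨆ s, MeasurableSpace.comap (y s) inferInstance] v) (hv1 : ∀ ω, |v ω| ≤ 1)
    (hFH : pastInc y T ≤ H) (hH : H ≤ chamberInfo x y t)
    (hxt : Measurable[H] (x t)) (M : ℤ) {Φ : Ω → ℝ}
    (hΦ : Measurable[H ⊔ MeasurableSpace.comap (x u) inferInstance] Φ) (hΦ1 : ∀ ω, |Φ ω| ≤ 1) :
    ∃ Φ' : Ω → ℝ, Measurable[H] Φ' ∧ (∀ ω, |Φ' ω| ≤ 1) ∧
      |∫ ω, v ω * Φ ω * (if x u ω ≤ M then 1 else 0) ∂P| ≤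
        |∫ ω, v ω * Φ' ω * (if x t ω ≤ M then 1 else 0) ∂P| +
          2 * P.real (badPiece x y t u ∩ {ω | x t ω ≤ M}) := by
  classical
  have hle := chamberInfo_le hx.measurable hy.measurable t
  obtain ⟨φ, hφm, hφ1, hφ⟩ := exists_factor_int hΦ hΦ1
  -- The cutoff is absorbed into the function of the new position. By monotonicity the cutoff at
  -- time `t` then comes for free.
  set ψ : ℤ → Ω → ℝ := fun k ω => if k ≤ M then φ k ω else 0 with hψ
  have hψm : ∀ k, Measurable[H] (ψ k) := fun k => by
    simp only [hψ]
    by_cases h : k ≤ M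
    · simpa [h] using hφm k
    · simp [h]
  have hψ1 : ∀ k ω, |ψ k ω| ≤ 1 := fun k ω => by
    simp only [hψ]
    split_ifs
    · exact hφ1 k ω
    · simp
  have hp : ∀ a, ∃ q : Ω → ℝ, Measurable[H] q ∧ (∀ ω, 0 ≤ q ω ∧ q ω ≤ 1) ∧
      clockProb α₀ α₁ y t u a =ᵐ[P] q := fun a => by
    obtain ⟨q, hq, he⟩ := aestronglyMeasurable_clockProb (α₀ := α₀) (α₁ := α₁) hy htu huT a
    refine ⟨fun ω => max 0 (min 1 (q ω)), ?_, fun ω => ⟨le_max_left _ _,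
      max_le zero_le_one (min_le_left _ _)⟩, ?_⟩
    · exact measurable_const.max (measurable_const.min (hq.measurable.mono hFH le_rfl))
    · filter_upwards [he] with ω hω
      rw [← hω, min_eq_right (clockProb_le_one hα y htu a ω),
        max_eq_right (clockProb_pos α₀ α₁ y t u a ω).le]
  choose q hqm hq01 hqe using hp
  have hq' : ∀ᵐ ω ∂P, ∀ a, clockProb α₀ α₁ y t u a ω = q a ω := ae_all_iff.2 hqe
  -- `pastInc` sees `y` only through its increments from time `0`, so `y u` is replaced by `y u - y
  -- 0`, which agrees with it almost surely.
  have hmax : Measurable[H] (fun ω => max (x t ω) (y u ω - y 0 ω)) :=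
    hxt.max ((measurable_pastInc y huT).mono hFH le_rfl)
  have hmax' : Measurable[H] (fun ω => max (x t ω) (y u ω - y 0 ω) + 1) :=
    (measurable_of_countable (fun k : ℤ => k + 1)).comp hmax
  -- `A` and `B` are the values at the predicted position without and with an own jump. Their
  -- average with weights `Q` and `1 - Q` is the new `Φ'`, which no longer involves `x u`.
  set A : Ω → ℝ := fun ω => ψ (max (x t ω) (y u ω - y 0 ω)) ω with hA
  set B : Ω → ℝ := fun ω => ψ (max (x t ω) (y u ω - y 0 ω) + 1) ω with hB
  set Q : Ω → ℝ := fun ω => q (x t ω) ω with hQ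
  have hAm : Measurable[H] A := measurable_comp_int hψm hmax
  have hBm : Measurable[H] B := measurable_comp_int hψm hmax'
  have hQm : Measurable[H] Q := measurable_comp_int hqm hxt
  have hA1 : ∀ ω, |A ω| ≤ 1 := fun ω => hψ1 _ ω
  have hB1 : ∀ ω, |B ω| ≤ 1 := fun ω => hψ1 _ ω
  have hΦ'm : Measurable[H] (fun ω => Q ω * A ω + (1 - Q ω) * B ω) :=
    (hQm.mul hAm).add ((measurable_const.sub hQm).mul hBm)
  have hI : Measurable[H] (fun ω => if x t ω ≤ M then (1 : ℝ) else 0) :=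
    (measurable_of_countable (fun k : ℤ => if k ≤ M then (1 : ℝ) else 0)).comp hxt
  have hv' : Measurable[chamberInfo x y t] v := hv.mono le_sup_left le_rfl
  refine ⟨fun ω => Q ω * A ω + (1 - Q ω) * B ω, hΦ'm,
    fun ω => abs_convex_le (hq01 _ ω).1 (hq01 _ ω).2 (hA1 ω) (hB1 ω), ?_⟩
  set N : Ω → ℝ := (noOwnJump x y t u).indicator (fun _ => (1 : ℝ)) with hN
  have hNm : AEStronglyMeasurable N P := (hx.integrable_noOwnJump htu).aestronglyMeasurable
  have hN01 : ∀ ω, 0 ≤ N ω ∧ N ω ≤ 1 := fun ω => by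
    simp only [hN, indicator]
    split_ifs <;> simp
  set I : Ω → ℝ := fun ω => if x t ω ≤ M then (1 : ℝ) else 0 with hIdef
  have hI1 : ∀ ω, |I ω| ≤ 1 := fun ω => abs_ite_one_le _
  have hvI : Measurable[chamberInfo x y t] (fun ω => v ω * I ω) := hv'.mul (hI.mono hH le_rfl)
  have hZ₁ : Measurable[chamberInfo x y t] (fun ω => v ω * I ω * (A ω - B ω)) :=
    hvI.mul ((hAm.mono hH le_rfl).sub (hBm.mono hH le_rfl))
  have hZ₂ : Measurable[chamberInfo x y t] (fun ω => v ω * I ω * B ω) :=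
    hvI.mul (hBm.mono hH le_rfl)
  have hvI1 : ∀ ω, |v ω * I ω| ≤ 1 := fun ω => abs_mul_le_one (hv1 ω) (hI1 ω)
  have hZ₁b : ∀ ω, |v ω * I ω * (A ω - B ω)| ≤ 2 := fun ω => by
    rw [abs_mul]
    have := abs_sub (A ω) (B ω)
    have h1 := hA1 ω
    have h2 := hB1 ω
    have h3 := hvI1 ω
    calc |v ω * I ω| * |A ω - B ω| ≤ 1 * 2 :=
          mul_le_mul h3 (by linarith) (abs_nonneg _) zero_le_one
      _ = 2 := by norm_num
  have hZ₂b : ∀ ω, |v ω * I ω * B ω| ≤ 1 := fun ω => abs_mul_le_one (hvI1 ω) (hB1 ω)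
  have hZ₂i : Integrable (fun ω => v ω * I ω * B ω) P :=
    ae_abs_le_integrable (hZ₂.mono hle le_rfl).aestronglyMeasurable (.of_forall hZ₂b)
  have hNZi : Integrable (fun ω => N ω * (v ω * I ω * (A ω - B ω))) P := by
    refine ae_abs_le_integrable (C := 2) (hNm.mul (hZ₁.mono hle le_rfl).aestronglyMeasurable)
      (.of_forall fun ω => ?_)
    rw [abs_mul]
    calc _ ≤ 1 * (2 : ℝ) := mul_le_mul (abs_le.2 ⟨by linarith [(hN01 ω).1], (hN01 ω).2⟩) (hZ₁b ω)
            (abs_nonneg _) zero_le_one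
      _ = 2 := by norm_num
  have hQZi : Integrable (fun ω => Q ω * (v ω * I ω * (A ω - B ω))) P := by
    refine ae_abs_le_integrable (C := 2)
      ((hQm.mono (hH.trans hle) le_rfl).mul (hZ₁.mono hle le_rfl)).aestronglyMeasurable
      (.of_forall fun ω => ?_)
    rw [abs_mul]
    calc _ ≤ 1 * (2 : ℝ) := mul_le_mul (abs_le.2 ⟨by linarith [(hq01 (x t ω) ω).1],
            (hq01 (x t ω) ω).2⟩) (hZ₁b ω) (abs_nonneg _) zero_le_one
      _ = 2 := by norm_num
  -- The clock identity replaces the indicator `N` by its conditional probability `Q`. It may be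
  -- tested against `v` although `v` depends on the future of `y`, since the conditioning includes
  -- the whole trajectory.
  have key : ∫ ω, (N ω * (v ω * I ω * (A ω - B ω)) + v ω * I ω * B ω) ∂P =
      ∫ ω, v ω * (Q ω * A ω + (1 - Q ω) * B ω) * I ω ∂P := by
    have h1 : ∫ ω, N ω * (v ω * I ω * (A ω - B ω)) ∂P =
        ∫ ω, Q ω * (v ω * I ω * (A ω - B ω)) ∂P := by
      rw [hx.integral_noOwnJump_mul hy.measurable htu hZ₁ hZ₁b]
      refine integral_congr_ae ?_
      filter_upwards [hq'] with ω hω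
      rw [hω]
    rw [integral_add hNZi hZ₂i, h1, ← integral_add hQZi hZ₂i]
    congr 1 with ω
    ring
  -- Prediction and reality differ only on the bad piece, where two quantities bounded by `1` are
  -- compared.
  have hcmp : ∀ᵐ ω ∂P, |v ω * Φ ω * (if x u ω ≤ M then 1 else 0) -
      (N ω * (v ω * I ω * (A ω - B ω)) + v ω * I ω * B ω)| ≤
        (badPiece x y t u ∩ {ω | x t ω ≤ M}).indicator (fun _ => (2 : ℝ)) ω := by
    filter_upwards [hx.path, hy.path] with ω hxω hyω
    have hmono : x t ω ≤ x u ω := hxω.mono htu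
    have e1 : v ω * Φ ω * (if x u ω ≤ M then 1 else 0) = v ω * I ω * ψ (x u ω) ω := by
      rw [hφ ω]
      by_cases h : x u ω ≤ M
      · simp [hψ, hIdef, h, hmono.trans h]
      · simp [hψ, h]
    have e2 : N ω * (v ω * I ω * (A ω - B ω)) + v ω * I ω * B ω =
        v ω * I ω * ψ (chamberStep x y t u ω) ω := by
      have : y u ω - y 0 ω = y u ω := by simp [hyω.zero]
      simp only [hN, hA, hB, chamberStep, this]
      by_cases h : ω ∈ noOwnJump x y t u
      · simp [h]; ring
      · simp [h]
    rw [e1, e2]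
    by_cases hb : ω ∈ badPiece x y t u
    · by_cases hM : x t ω ≤ M
      · have hmem : ω ∈ badPiece x y t u ∩ {ω | x t ω ≤ M} := ⟨hb, hM⟩
        rw [indicator_of_mem hmem, ← mul_sub, abs_mul]
        have := abs_sub (ψ (x u ω) ω) (ψ (chamberStep x y t u ω) ω)
        have h1 := hψ1 (x u ω) ω
        have h2 := hψ1 (chamberStep x y t u ω) ω
        calc _ ≤ 1 * (2 : ℝ) :=
              mul_le_mul (hvI1 ω) (by linarith) (abs_nonneg _) zero_le_one
          _ = 2 := by norm_num
      · have : I ω = 0 := by simp [hIdef, hM]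
        simp only [this, mul_zero, zero_mul, sub_zero, abs_zero]
        exact indicator_nonneg (fun _ _ => by norm_num) ω
    · have : x u ω = chamberStep x y t u ω := not_not.1 hb
      rw [← this, sub_self, abs_zero]
      exact indicator_nonneg (fun _ _ => by norm_num) ω
  have hbad : NullMeasurableSet (badPiece x y t u ∩ {ω | x t ω ≤ M}) P :=
    (hx.nullMeasurableSet_badPiece hy.measurable htu).inter
      (measurableSet_le (hx.measurable t) measurable_const).nullMeasurableSet
  have hbi : Integrable ((badPiece x y t u ∩ {ω | x t ω ≤ M}).indicator (fun _ => (2 : ℝ))) P :=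
    (integrable_const (2 : ℝ)).indicator₀ hbad
  have hΦm : Measurable Φ := hΦ.mono (sup_le (hH.trans hle) (hx.measurable u).comap_le) le_rfl
  have hfull : Integrable (fun ω => v ω * Φ ω * (if x u ω ≤ M then 1 else 0)) P := by
    refine ae_abs_le_integrable (C := 1) (((hv'.mono hle le_rfl).mul hΦm).mul
      ((measurable_of_countable (fun k : ℤ => if k ≤ M then (1 : ℝ) else 0)).comp
        (hx.measurable u))).aestronglyMeasurable (.of_forall fun ω => ?_)
    exact abs_mul_le_one (abs_mul_le_one (hv1 ω) (hΦ1 ω)) (abs_ite_one_le _)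
  have hdiff : |∫ ω, v ω * Φ ω * (if x u ω ≤ M then 1 else 0) ∂P -
      ∫ ω, v ω * (Q ω * A ω + (1 - Q ω) * B ω) * I ω ∂P| ≤
        2 * P.real (badPiece x y t u ∩ {ω | x t ω ≤ M}) := by
    rw [← key]
    refine (congrArg _ (integral_sub hfull (hNZi.add hZ₂i))).symm.trans_le ?_
    refine abs_integral_le_integral_abs.trans ((integral_mono_ae
      (hfull.sub (hNZi.add hZ₂i)).abs hbi hcmp).trans_eq ?_)
    rw [integral_indicator₀ hbad, setIntegral_const, smul_eq_mul, mul_comm]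
  have := abs_sub_abs_le_abs_sub (∫ ω, v ω * Φ ω * (if x u ω ≤ M then 1 else 0) ∂P)
    (∫ ω, v ω * (Q ω * A ω + (1 - Q ω) * B ω) * I ω ∂P)
  linarith

end Causality

/-! ### Fine time grids through prescribed times. -/

section Grid

lemma exists_grid (T : ℝ≥0) (S : Finset ℝ≥0) (hS : ∀ s ∈ S, s ≤ T) (n : ℕ) :
    ∃ τ : ℕ → ℝ≥0, Monotone τ ∧ τ 0 = 0 ∧ (∀ i, τ i ≤ T) ∧ (∃ j, τ j = T) ∧
      (∀ s ∈ S, ∃ i, τ i = s) ∧ ∀ i, (τ (i + 1) : ℝ) ≤ τ i + 1 / (n + 1) := by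
  classical
  set G : Finset ℝ≥0 := (Finset.range (⌈T * (n + 1)⌉₊ + 1)).image
    (fun k : ℕ => min T (k / (n + 1))) with hG
  obtain ⟨τ, hτ, hr⟩ := exists_monotone_range_eq_finset ({0, T} ∪ (S ∪ G)) ⟨0, by simp⟩
  have mem : ∀ a ∈ ({0, T} ∪ (S ∪ G) : Finset ℝ≥0), ∃ i, τ i = a := fun a ha => by
    have : a ∈ range τ := by rw [hr]; exact ha
    exact this
  have hT : ∀ i, τ i ≤ T := by
    intro i
    have : τ i ∈ ({0, T} ∪ (S ∪ G) : Finset ℝ≥0) := by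
      have : τ i ∈ range τ := mem_range_self i
      rwa [hr, Finset.mem_coe] at this
    simp only [hG, Finset.mem_union, Finset.mem_insert,
      Finset.mem_singleton, Finset.mem_image] at this
    rcases this with (h | h) | h | ⟨k, -, h⟩
    · simp [h]
    · exact h.le
    · exact hS _ h
    · exact h ▸ min_le_left _ _
  refine ⟨τ, hτ, ?_, hT, mem T (by simp), fun s hs => mem s (by simp [hs]), fun i => ?_⟩
  · obtain ⟨i, hi⟩ := mem 0 (by simp)
    exact le_antisymm (hi ▸ hτ (Nat.zero_le i)) zero_le
  · rcases (hT i).eq_or_lt with h | h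
    · have h1 : (τ (i + 1) : ℝ) ≤ τ i := by rw [h]; exact_mod_cast hT (i + 1)
      have : (0 : ℝ) ≤ 1 / (n + 1) := by positivity
      linarith
    -- The first multiple of `1 / (n + 1)` strictly above `τ i`, capped at `T`, belongs to the grid
    -- and bounds the next grid time.
    · set k := ⌊τ i * (n + 1)⌋₊ + 1 with hk
      have hkG : min T ((k : ℝ≥0) / (n + 1)) ∈ G := by
        rw [hG]
        refine Finset.mem_image_of_mem (fun k : ℕ => min T ((k : ℝ≥0) / (n + 1)))
          (Finset.mem_range.2 ?_)
        have : ⌊τ i * (n + 1)⌋₊ < ⌈T * (n + 1)⌉₊ := by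
          rw [Nat.floor_lt (by positivity)]
          exact (mul_lt_mul_of_pos_right h (by positivity)).trans_le (Nat.le_ceil _)
        omega
      obtain ⟨j, hj⟩ := mem _ (by simp only [Finset.mem_union]; exact .inr (.inr hkG))
      have hlt : τ i < τ j := by
        rw [hj]
        refine lt_min h ?_
        rw [lt_div_iff₀ (by positivity), hk]
        push_cast
        exact Nat.lt_floor_add_one _
      have hij : i + 1 ≤ j := by
        by_contra hcon
        exact absurd (hτ (show j ≤ i by omega)) (not_le.2 hlt)
      have h1 : τ (i + 1) ≤ τ i + 1 / (n + 1) := by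
        refine (hτ hij).trans ((hj ▸ min_le_right _ _ : τ j ≤ (k : ℝ≥0) / (n + 1)).trans ?_)
        have e : (τ i + 1 / ((n : ℝ≥0) + 1)) * (n + 1) = τ i * (n + 1) + 1 := by field_simp
        rw [div_le_iff₀ (by positivity), e, hk]
        push_cast
        gcongr
        exact Nat.floor_le (by positivity)
      exact_mod_cast h1

end Grid

/-! ### The walk does not anticipate the future of the wall. -/

section Causality

/-- The information in `F` and in the positions of `X` at the first times of the grid `τ`. -/
@[reducible] def gridInfo {Ω : Type*} (F : MeasurableSpace Ω) (X : ℝ≥0 → Ω → ℤ) (τ : ℕ → ℝ≥0) :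
    ℕ → MeasurableSpace Ω
  | 0 => F ⊔ MeasurableSpace.comap (X (τ 0)) inferInstance
  | i + 1 => gridInfo F X τ i ⊔ MeasurableSpace.comap (X (τ (i + 1))) inferInstance

lemma le_gridInfo {Ω : Type*} (F : MeasurableSpace Ω) (X : ℝ≥0 → Ω → ℤ) (τ : ℕ → ℝ≥0) (i : ℕ) :
    F ≤ gridInfo F X τ i := by
  induction i with
  | zero => exact le_sup_left
  | succ i ih => exact ih.trans le_sup_left

lemma measurable_gridInfo {Ω : Type*} (F : MeasurableSpace Ω) (X : ℝ≥0 → Ω → ℤ) (τ : ℕ → ℝ≥0)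
    {i j : ℕ} (hij : j ≤ i) : Measurable[gridInfo F X τ i] (X (τ j)) := by
  refine Measurable.of_comap_le ?_
  induction i with
  | zero =>
    obtain rfl : j = 0 := by omega
    exact le_sup_right
  | succ i ih =>
    rcases hij.lt_or_eq with h | rfl
    · exact (ih (by omega)).trans le_sup_left
    · exact le_sup_right

lemma gridInfo_le_chamberInfo {Ω : Type*} (X Y : ℝ≥0 → Ω → ℤ) {τ : ℕ → ℝ≥0} (hτ : Monotone τ)
    (T : ℝ≥0) (i : ℕ) : gridInfo (pastInc Y T) X τ i ≤ chamberInfo X Y (τ i) := by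
  induction i with
  | zero =>
    exact sup_le (pastInc_le_chamberInfo X Y T _)
      (measurable_chamberInfo_right X Y le_rfl).comap_le
  | succ i ih =>
    exact sup_le (ih.trans (chamberInfo_mono X Y (hτ (Nat.le_succ i))))
      (measurable_chamberInfo_right X Y le_rfl).comap_le

/-- Every bad piece forces `X` to move up by at least `1`, so the increments of `X` truncated at `M
+ 1` dominate the indicators and telescope. The bound is uniform in the grid, as dominated
convergence requires. -/
lemma sum_indicator_badPiece_le {Ω : Type*} {X Y : ℝ≥0 → Ω → ℤ} {ω : Ω} (hX : Monotone (fun s => X s ω))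
    (hX0 : X 0 ω = 0) (hXY : ∀ s, Y s ω ≤ X s ω) {τ : ℕ → ℝ≥0} (hτ : Monotone τ) {M : ℤ}
    (hM : 0 ≤ M) (i : ℕ) :
    ∑ j ∈ Finset.range i, (badPiece X Y (τ j) (τ (j + 1)) ∩ {ω | X (τ j) ω ≤ M}).indicator
      (fun _ => (1 : ℝ)) ω ≤ M + 1 := by
  have h0 : ∀ s, 0 ≤ X s ω := fun s => hX0 ▸ hX zero_le
  have : ∀ j ∈ Finset.range i,
      (badPiece X Y (τ j) (τ (j + 1)) ∩ {ω | X (τ j) ω ≤ M}).indicator (fun _ => (1 : ℝ)) ω ≤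
        ((min (X (τ (j + 1)) ω) (M + 1) - min (X (τ j) ω) (M + 1) : ℤ) : ℝ) := by
    intro j _
    have hm : X (τ j) ω ≤ X (τ (j + 1)) ω := hX (hτ (Nat.le_succ j))
    by_cases h : ω ∈ badPiece X Y (τ j) (τ (j + 1)) ∩ {ω | X (τ j) ω ≤ M}
    · rw [indicator_of_mem h]
      have h1 : X (τ (j + 1)) ω ≠ X (τ j) ω := fun e => notMem_badPiece_of_eq hX hXY e h.1
      have h2 : X (τ j) ω ≤ M := h.2
      have : 1 ≤ min (X (τ (j + 1)) ω) (M + 1) - min (X (τ j) ω) (M + 1) := by omega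
      exact_mod_cast this
    · rw [indicator_of_notMem h]
      have : 0 ≤ min (X (τ (j + 1)) ω) (M + 1) - min (X (τ j) ω) (M + 1) := by omega
      exact_mod_cast this
  refine (Finset.sum_le_sum this).trans ?_
  rw [← Int.cast_sum, Finset.sum_range_sub (fun j => min (X (τ j) ω) (M + 1))]
  have h1 := h0 (τ i)
  have h2 := h0 (τ 0)
  have : min (X (τ i) ω) (M + 1) - min (X (τ 0) ω) (M + 1) ≤ M + 1 := by omega
  exact_mod_cast this

variable {Ω : Type*} [MeasurableSpace Ω] {P : Measure Ω} [IsProbabilityMeasure P] {α₀ α₁ : ℝ≥0}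
  {x y : ℝ≥0 → Ω → ℤ}

/-- Grid times are removed one by one from the end, each at the cost of one bad piece. At time `0`
the walk is at `0`, so only a functional of the past of `y` remains, and `v` annihilates it. -/
lemma IsChamberWalk.abs_integral_grid_le (hα : α₁ < α₀) {r : ℝ≥0} (hy : IsPoissonWalk r y P)
    (hx : IsChamberWalk α₀ α₁ x y P) {T : ℝ≥0} {v : Ω → ℝ}
    (hv : Measurable[⨆ s, MeasurableSpace.comap (y s) inferInstance] v) (hv1 : ∀ ω, |v ω| ≤ 1)
    (hv0 : ∀ Ψ : Ω → ℝ, Measurable[pastInc y T] Ψ → (∀ ω, |Ψ ω| ≤ 1) → ∫ ω, v ω * Ψ ω ∂P = 0)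
    {τ : ℕ → ℝ≥0} (hτ : Monotone τ) (hτ0 : τ 0 = 0) (hτT : ∀ i, τ i ≤ T) {M : ℤ} (hM : 0 ≤ M)
    (i : ℕ) {Φ : Ω → ℝ} (hΦ : Measurable[gridInfo (pastInc y T) x τ i] Φ) (hΦ1 : ∀ ω, |Φ ω| ≤ 1) :
    |∫ ω, v ω * Φ ω * (if x (τ i) ω ≤ M then 1 else 0) ∂P| ≤ 2 * ∑ j ∈ Finset.range i,
      P.real (badPiece x y (τ j) (τ (j + 1)) ∩ {ω | x (τ j) ω ≤ M}) := by
  induction i generalizing Φ with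
  | zero =>
    obtain ⟨φ, hφm, hφ1, hφ⟩ := exists_factor_int hΦ hΦ1
    have : ∫ ω, v ω * Φ ω * (if x (τ 0) ω ≤ M then 1 else 0) ∂P = ∫ ω, v ω * φ 0 ω ∂P := by
      refine integral_congr_ae ?_
      filter_upwards [hx.path] with ω hω
      have := hω.zero
      rw [hφ ω, hτ0, this]
      simp [hM]
    rw [this, hv0 _ (hφm 0) (hφ1 0)]
    simp
  | succ i ih =>
    obtain ⟨Φ', hΦ', hΦ'1, hle⟩ := hx.exists_step (H := gridInfo (pastInc y T) x τ i) hα hy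
      (hτ (Nat.le_succ i)) (hτT (i + 1)) hv hv1
      (le_gridInfo _ _ _ _) (gridInfo_le_chamberInfo x y hτ T i) (measurable_gridInfo _ _ _ le_rfl)
      M hΦ hΦ1
    have := ih hΦ' hΦ'1
    rw [Finset.sum_range_succ, mul_add]
    exact hle.trans (by linarith)

/-- The position of the chamber walk up to time `T` does not anticipate `Y`: a functional of `Y`
that is uncorrelated with the past of `Y` is uncorrelated with the past of `X` and `Y`. -/
theorem IsChamberWalk.integral_mul_eq_zero (hα : α₁ < α₀) {r : ℝ≥0} (hy : IsPoissonWalk r y P)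
    (hx : IsChamberWalk α₀ α₁ x y P) {T : ℝ≥0} {v : Ω → ℝ}
    (hv : Measurable[⨆ s, MeasurableSpace.comap (y s) inferInstance] v) (hv1 : ∀ ω, |v ω| ≤ 1)
    (hv0 : ∀ Ψ : Ω → ℝ, Measurable[pastInc y T] Ψ → (∀ ω, |Ψ ω| ≤ 1) → ∫ ω, v ω * Ψ ω ∂P = 0)
    (S : Finset ℝ≥0) (hS : ∀ s ∈ S, s ≤ T) {Φ : Ω → ℝ}
    (hΦ : Measurable[pastInc y T ⊔ ⨆ s ∈ S, MeasurableSpace.comap (x s) inferInstance] Φ)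
    (hΦ1 : ∀ ω, |Φ ω| ≤ 1) :
    ∫ ω, v ω * Φ ω ∂P = 0 := by
  choose τ hτ hτ0 hτT hτj hτS hmesh using exists_grid T S hS
  choose j hj using hτj
  have hvm : Measurable v := hv.mono (iSup_le fun s => (hy.measurable s).comap_le) le_rfl
  have hΦm : Measurable Φ := hΦ.mono (sup_le (pastInc_le hy.measurable T)
    (iSup₂_le fun s _ => (hx.measurable s).comap_le)) le_rfl
  have hgrid : ∀ n, Measurable[gridInfo (pastInc y T) x (τ n) (j n)] Φ := by
    intro n
    refine hΦ.mono (sup_le (le_gridInfo _ _ _ _) (iSup₂_le fun s hs => ?_)) le_rfl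
    obtain ⟨i, hi⟩ := hτS n s hs
    rcases le_total i (j n) with h | h
    · exact hi ▸ (measurable_gridInfo _ _ _ h).comap_le
    · have : s = τ n (j n) := le_antisymm ((hS s hs).trans_eq (hj n).symm) (hi ▸ hτ n h)
      exact this ▸ (measurable_gridInfo _ _ _ le_rfl).comap_le
  have hM : ∀ M : ℕ, ∫ ω, v ω * Φ ω * (if x T ω ≤ M then 1 else 0) ∂P = 0 := by
    intro M
    set B : ℕ → ℕ → Set Ω := fun n i =>
      badPiece x y (τ n i) (τ n (i + 1)) ∩ {ω | x (τ n i) ω ≤ (M : ℤ)} with hB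
    have hBm : ∀ n i, NullMeasurableSet (B n i) P := fun n i =>
      (hx.nullMeasurableSet_badPiece hy.measurable (hτ n (Nat.le_succ i))).inter
        (measurableSet_le (hx.measurable _) measurable_const).nullMeasurableSet
    have hDi : ∀ n i, Integrable ((B n i).indicator (fun _ => (1 : ℝ))) P := fun n i =>
      (integrable_const (1 : ℝ)).indicator₀ (hBm n i)
    have hsum : ∀ n, ∑ i ∈ Finset.range (j n), P.real (B n i) =
        ∫ ω, ∑ i ∈ Finset.range (j n), (B n i).indicator (fun _ => (1 : ℝ)) ω ∂P := fun n => by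
      rw [integral_finsetSum _ fun i _ => hDi n i]
      refine Finset.sum_congr rfl fun i _ => ?_
      rw [integral_indicator₀ (hBm n i), setIntegral_const, smul_eq_mul, mul_one]
    -- For each path there are no bad pieces once the mesh is below the scale given by
    -- `exists_mesh`; the height cutoff `M` supplies the domination.
    have hlim : Tendsto (fun n => ∑ i ∈ Finset.range (j n), P.real (B n i)) atTop (𝓝 0) := by
      simp_rw [hsum]
      rw [← integral_zero Ω ℝ (μ := P)]
      refine tendsto_integral_of_dominated_convergence (fun _ => (M : ℝ) + 1)
        (fun n => (integrable_finsetSum _ fun i _ => hDi n i).aestronglyMeasurable)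
        (integrable_const _) (fun n => ?_) ?_
      · filter_upwards [hx.path, hx.chamber] with ω h1 h2
        rw [Real.norm_of_nonneg (Finset.sum_nonneg fun i _ =>
          indicator_nonneg (fun _ _ => zero_le_one) ω)]
        exact sum_indicator_badPiece_le (M := (M : ℤ)) h1.mono h1.zero h2 (hτ n) (by positivity) _
      · filter_upwards [hx.path, hx.chamber, hy.path] with ω h1 h2 h3
        obtain ⟨δ, hδ, H⟩ := h1.exists_mesh h3 T
        refine tendsto_nhds_of_eventually_eq ?_
        have : ∀ᶠ n : ℕ in atTop, 1 / ((n : ℝ) + 1) < δ :=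
          tendsto_one_div_add_atTop_nhds_zero_nat.eventually_lt_const hδ
        filter_upwards [this] with n hn
        refine Finset.sum_eq_zero fun i _ => indicator_of_notMem (fun hmem => ?_) _
        have hle := hτ n (Nat.le_succ i)
        obtain ⟨h4, c, hl, hr⟩ := H (τ n i) (τ n (i + 1)) hle (hτT n _)
          (by have := hmesh n i; linarith)
        exact notMem_badPiece_of_single hle h1.mono h2 h4 hl hr hmem.1
    have hbd : ∀ n, |∫ ω, v ω * Φ ω * (if x T ω ≤ M then 1 else 0) ∂P| ≤
        2 * ∑ i ∈ Finset.range (j n), P.real (B n i) := fun n => by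
      have := hx.abs_integral_grid_le hα hy hv hv1 hv0 (hτ n) (hτ0 n) (hτT n) (M := (M : ℤ))
        (by positivity) (j n) (hgrid n) hΦ1
      rwa [hj n] at this
    have := ge_of_tendsto' (by simpa using hlim.const_mul 2) hbd
    exact abs_eq_zero.1 (le_antisymm this (abs_nonneg _))
  have hlim : Tendsto (fun M : ℕ => ∫ ω, v ω * Φ ω * (if x T ω ≤ M then 1 else 0) ∂P) atTop
      (𝓝 (∫ ω, v ω * Φ ω ∂P)) := by
    refine tendsto_integral_of_dominated_convergence (fun _ => 1) (fun M => ?_)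
      (integrable_const _) (fun M => .of_forall fun ω => ?_) (.of_forall fun ω => ?_)
    · exact ((hvm.mul hΦm).mul ((measurable_of_countable
        (fun k : ℤ => if k ≤ M then (1 : ℝ) else 0)).comp (hx.measurable T))).aestronglyMeasurable
    · exact abs_mul_le_one (abs_mul_le_one (hv1 ω) (hΦ1 ω)) (abs_ite_one_le _)
    · refine tendsto_nhds_of_eventually_eq ?_
      filter_upwards [eventually_ge_atTop (x T ω).toNat] with M hM
      have : x T ω ≤ M := by omega
      simp [this]
  simp_rw [hM] at hlim
  exact tendsto_nhds_unique hlim tendsto_const_nhds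

end Causality

/-! ### Exponential moment of an occupation time. -/

section PoissonComputation

open Nat in
lemma hasDerivAt_poisson_cdf (q : ℕ) (z : ℝ) :
    HasDerivAt (fun z : ℝ => ∑ k ∈ Finset.range (q + 1), Real.exp (-z) * z ^ k / (k ! : ℝ))
      (-(Real.exp (-z) * z ^ q / (q ! : ℝ))) z := by
  have he : HasDerivAt (fun z : ℝ => Real.exp (-z)) (-Real.exp (-z)) z := by
    simpa using (hasDerivAt_neg z).exp
  induction q with
  | zero => simpa using he
  | succ q ih =>
    have h2 := ((he.mul (hasDerivAt_pow (q + 1) z)).div_const ((q + 1)! : ℝ))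
    have h3 := ih.add h2
    have e : (fun z : ℝ => ∑ k ∈ Finset.range (q + 1 + 1), Real.exp (-z) * z ^ k / (k ! : ℝ)) =
        (fun z : ℝ => ∑ k ∈ Finset.range (q + 1), Real.exp (-z) * z ^ k / (k ! : ℝ)) +
        fun z : ℝ => ((fun z : ℝ => Real.exp (-z)) * fun z : ℝ => z ^ (q + 1)) z /
          ((q + 1)! : ℝ) := by
      ext z
      rw [Finset.sum_range_succ]
      simp
    rw [e]
    refine h3.congr_deriv ?_
    rw [Nat.factorial_succ]
    push_cast
    have : (q ! : ℝ) ≠ 0 := by positivity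
    field_simp
    ring

open Nat in
lemma integral_poisson_density (c : ℝ) (q : ℕ) (t u : ℝ) :
    ∫ s in t..u, c * (Real.exp (-(c * (s - t))) * (c * (s - t)) ^ q / (q ! : ℝ)) =
      1 - ∑ k ∈ Finset.range (q + 1), Real.exp (-(c * (u - t))) * (c * (u - t)) ^ k / (k ! : ℝ) := by
  have hd : ∀ s ∈ uIcc t u, HasDerivAt (fun s => -∑ k ∈ Finset.range (q + 1),
      Real.exp (-(c * (s - t))) * (c * (s - t)) ^ k / (k ! : ℝ))
      (c * (Real.exp (-(c * (s - t))) * (c * (s - t)) ^ q / (q ! : ℝ))) s := by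
    intro s _
    have h1 : HasDerivAt (fun s : ℝ => c * (s - t)) c s := by
      simpa using ((hasDerivAt_id s).sub_const t).const_mul c
    have h2 := ((hasDerivAt_poisson_cdf q (c * (s - t))).comp s h1).neg
    exact h2.congr_deriv (by ring)
  rw [intervalIntegral.integral_eq_sub_of_hasDerivAt hd
    (Continuous.intervalIntegrable (by fun_prop) _ _)]
  have h0 : ∑ k ∈ Finset.range (q + 1), Real.exp (-(c * (t - t))) * (c * (t - t)) ^ k / (k ! : ℝ)
      = 1 := by
    rw [Finset.sum_range_succ']
    simp
  rw [h0]
  ring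

/-- A monotone path ending at `q` spends a final interval at `q`, up to the endpoint, which is
Lebesgue-null. -/
lemma exists_integral_ite_eq {g : ℝ → ℤ} (hg : Monotone g) {t u : ℝ} (htu : t ≤ u) {q : ℤ}
    (hq : g u = q) : ∃ τ, ∀ f : ℝ → ℝ,
      ∫ s in t..u, (if g s = q then f s else 0) = ∫ s in τ..u, f s := by
  set A := {s | s ∈ Icc t u ∧ g s = q}
  have hu : u ∈ A := ⟨⟨htu, le_rfl⟩, hq⟩
  have hbdd : BddBelow A := ⟨t, fun s hs => hs.1.1⟩
  have hτu : sInf A ≤ u := csInf_le hbdd hu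
  have htτ : t ≤ sInf A := le_csInf ⟨u, hu⟩ fun s hs => hs.1.1
  refine ⟨sInf A, fun f => ?_⟩
  rw [intervalIntegral.integral_of_le htu, intervalIntegral.integral_of_le hτu]
  have e : Ioc (sInf A) u = Ioc t u ∩ Ioc (sInf A) u :=
    (inter_eq_right.2 (Ioc_subset_Ioc_left htτ)).symm
  rw [e, ← setIntegral_indicator measurableSet_Ioc]
  refine setIntegral_congr_ae measurableSet_Ioc ?_
  filter_upwards [Measure.ae_ne volume (sInf A)] with s hs hsI
  rcases lt_or_gt_of_ne hs with h | h
  · have h1 : g s ≠ q := fun e => (csInf_le hbdd (⟨⟨hsI.1.le, hsI.2⟩, e⟩ : s ∈ A)).not_gt h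
    have h2 : s ∉ Ioc (sInf A) u := fun h' => h'.1.not_gt h
    rw [if_neg h1, indicator_of_notMem h2]
  · obtain ⟨r, hr, hrs⟩ := exists_lt_of_csInf_lt ⟨u, hu⟩ h
    have h1 : g s = q := le_antisymm (hq ▸ hg hsI.2) (hr.2 ▸ hg hrs.le)
    have h2 : s ∈ Ioc (sInf A) u := ⟨h, hsI.2⟩
    rw [if_pos h1, indicator_of_mem h2]

lemma integral_const_mul_exp (c τ u : ℝ) :
    ∫ s in τ..u, c * Real.exp (c * (u - s)) = Real.exp (c * (u - τ)) - 1 := by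
  have hd : ∀ s ∈ uIcc τ u, HasDerivAt (fun s => -Real.exp (c * (u - s)))
      (c * Real.exp (c * (u - s))) s := by
    intro s _
    have h1 : HasDerivAt (fun s : ℝ => c * (u - s)) (-c) s := by
      simpa using ((hasDerivAt_id s).const_sub u).const_mul c
    exact h1.exp.neg.congr_deriv (by ring)
  rw [intervalIntegral.integral_eq_sub_of_hasDerivAt hd
    (Continuous.intervalIntegrable (by fun_prop) _ _)]
  simp
  ring

/-- If the path ends at `q`, its occupation time is the length of a final interval, and the
exponential is one plus the integral of its derivative. This replaces an exponential functional of
the path by an integral of two-time events. -/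
lemma exp_occupation_eq {g : ℝ → ℤ} (hg : Monotone g) {t u : ℝ} (htu : t ≤ u) (q : ℤ) (c : ℝ) :
    (if g u ≤ q then Real.exp (c * ∫ s in t..u, if g s = q then 1 else 0) else 0) =
      (if g u ≤ q then 1 else 0) + ∫ s in t..u, c * Real.exp (c * (u - s)) *
        ((if g s = q then 1 else 0) * (if g u = q then 1 else 0)) := by
  rcases lt_trichotomy (g u) q with h | h | h
  · have : ∀ s ∈ uIcc t u, (if g s = q then (1 : ℝ) else 0) = 0 := fun s hs => by
      rw [uIcc_of_le htu] at hs
      exact if_neg ((hg hs.2).trans_lt h).ne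
    rw [intervalIntegral.integral_congr this]
    simp [h.le, h.ne]
  · obtain ⟨τ, hτ⟩ := exists_integral_ite_eq hg htu h
    have e : ∀ s, c * Real.exp (c * (u - s)) * ((if g s = q then 1 else 0) *
        (if g u = q then 1 else 0)) = if g s = q then c * Real.exp (c * (u - s)) else 0 :=
      fun s => by simp [h]
    simp_rw [e]
    rw [hτ (fun _ => 1), hτ (fun s => c * Real.exp (c * (u - s))), integral_const_mul_exp]
    simp [h]
  · simp [h.ne', h.not_ge]

variable {Ω : Type*} [MeasurableSpace Ω] {P : Measure Ω} {c : ℝ≥0}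
  {y : ℝ≥0 → Ω → ℤ}

lemma IsPoissonWalk.measureReal_sub_mem (hy : IsPoissonWalk c y P) {s t : ℝ≥0} (hst : s ≤ t)
    (B : Set ℤ) : P.real {ω | y t ω - y s ω ∈ B} =
      (poissonMeasure (c * (t - s))).real ((fun n : ℕ => (n : ℤ)) ⁻¹' B) := by
  have h := (hy.law s t hst).map_eq
  have hm : Measurable (fun ω => y t ω - y s ω) := (hy.measurable t).sub (hy.measurable s)
  have := congrArg (fun μ : Measure ℤ => μ.real B) h
  rwa [map_measureReal_apply hm (MeasurableSet.of_discrete),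
    map_measureReal_apply .of_discrete (MeasurableSet.of_discrete)] at this

open Nat in
lemma IsPoissonWalk.measureReal_sub_eq (hy : IsPoissonWalk c y P) {s t : ℝ≥0} (hst : s ≤ t)
    (q : ℕ) : P.real {ω | y t ω - y s ω = q} =
      Real.exp (-(c * ((t : ℝ) - s))) * (c * ((t : ℝ) - s)) ^ q / (q ! : ℝ) := by
  have h := hy.measureReal_sub_mem hst {(q : ℤ)}
  have e : (fun n : ℕ => (n : ℤ)) ⁻¹' {(q : ℤ)} = {q} := by ext; simp
  rw [e, poissonMeasure_real_singleton] at h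
  simp only [mem_singleton_iff] at h
  rw [h]
  push_cast [NNReal.coe_sub hst]
  rfl

open Nat in
lemma IsPoissonWalk.measureReal_sub_le (hy : IsPoissonWalk c y P) {s t : ℝ≥0} (hst : s ≤ t)
    (q : ℕ) : P.real {ω | y t ω - y s ω ≤ q} = ∑ k ∈ Finset.range (q + 1),
      Real.exp (-(c * ((t : ℝ) - s))) * (c * ((t : ℝ) - s)) ^ k / (k ! : ℝ) := by
  have h := hy.measureReal_sub_mem hst (Iic (q : ℤ))
  have e : (fun n : ℕ => (n : ℤ)) ⁻¹' Iic (q : ℤ) = (Finset.range (q + 1) : Set ℕ) := by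
    ext; simp
  rw [e, ← sum_measureReal_singleton] at h
  simp only [mem_Iic] at h
  rw [h]
  refine Finset.sum_congr rfl fun k _ => ?_
  rw [poissonMeasure_real_singleton]
  push_cast [NNReal.coe_sub hst]
  rfl

lemma IsPoissonWalk.measureReal_stay (hy : IsPoissonWalk c y P) {t s u : ℝ≥0} (hts : t ≤ s)
    (hsu : s ≤ u) (q : ℤ) : P.real {ω | y s ω - y t ω = q ∧ y u ω - y t ω = q} =
      P.real {ω | y s ω - y t ω = q} * Real.exp (-(c * ((u : ℝ) - s))) := by
  have hi := hy.indep.indepFun_sub_sub hts hsu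
  have h := hi.measure_inter_preimage_eq_mul {q} {0} (.of_discrete) (.of_discrete)
  have h0 := hy.measureReal_sub_eq hsu 0
  simp only [pow_zero, Nat.factorial_zero, Nat.cast_one, mul_one, div_one, Nat.cast_zero] at h0
  rw [← h0]
  simp only [Measure.real, ← ENNReal.toReal_mul]
  congr 1
  refine Eq.trans (congrArg P ?_) h
  ext ω
  simp only [mem_ofPred_eq, mem_inter_iff, mem_preimage, mem_singleton_iff, Pi.sub_apply]
  omega

/-- The exponential moment of the time that a Poisson walk spends at `q`, on the event that it
does not go beyond `q`. -/
theorem IsPoissonWalk.integral_exp_occupation [IsProbabilityMeasure P] (hy : IsPoissonWalk c y P) {t u : ℝ≥0}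
    (htu : t ≤ u) (q : ℕ) :
    ∫ ω, (if y u ω - y t ω ≤ q then Real.exp (c * ∫ s in (t : ℝ)..u,
      if y s.toNNReal ω - y t ω = q then 1 else 0) else 0) ∂P = 1 := by
  have htu' : (t : ℝ) ≤ u := htu
  set K : ℝ → Ω → ℝ := fun s ω => c * Real.exp (c * (u - s)) *
    ((if y s.toNNReal ω - y t ω = q then 1 else 0) * (if y u ω - y t ω = q then 1 else 0)) with hK
  have hsm : ∀ s, Measurable (fun ω => y s ω - y t ω) := fun s =>
    (hy.measurable s).sub (hy.measurable t)
  have hI : Integrable (fun ω => if y u ω - y t ω ≤ q then (1 : ℝ) else 0) P :=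
    ae_abs_le_integrable (C := 1) ((measurable_of_countable
      (fun k : ℤ => if k ≤ q then (1 : ℝ) else 0)).comp (hsm u)).aestronglyMeasurable
      (.of_forall fun ω => abs_ite_one_le _)
  have hKi : Integrable (Function.uncurry K) ((volume.restrict (Ioc (t : ℝ) u)).prod P) := by
    have h1 := aestronglyMeasurable_prod_of_rightCts (P := P) (Z := fun s ω => y s ω - y t ω) htu
      (fun s _ => hsm s) (by
        filter_upwards [hy.path] with ω hω s
        filter_upwards [hω.rightCts s] with r hr
        rw [hr]) (fun k => if k = q then 1 else 0)
    have h2 : Measurable (fun p : ℝ × Ω => if y u p.2 - y t p.2 = q then (1 : ℝ) else 0) :=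
      ((measurable_of_countable (fun k : ℤ => if k = q then (1 : ℝ) else 0)).comp
        (hsm u)).comp measurable_snd
    have h3 : Measurable (fun p : ℝ × Ω => (c : ℝ) * Real.exp (c * (u - p.1))) := by fun_prop
    refine Integrable.of_bound (h3.aestronglyMeasurable.mul (h1.mul h2.aestronglyMeasurable))
      (c * Real.exp (c * (u - t))) ?_
    have h4 : ∀ᵐ p : ℝ × Ω ∂((volume.restrict (Ioc (t : ℝ) u)).prod P), p.1 ∈ Ioc (t : ℝ) u :=
      Measure.quasiMeasurePreserving_fst.ae (ae_restrict_mem measurableSet_Ioc)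
    filter_upwards [h4] with p hp
    rw [Function.uncurry, hK, Real.norm_eq_abs, abs_mul, abs_of_nonneg (by positivity)]
    have h5 := abs_mul_le_one (abs_ite_one_le (y p.1.toNNReal p.2 - y t p.2 = q))
      (abs_ite_one_le (y u p.2 - y t p.2 = q))
    refine (mul_le_of_le_one_right (by positivity) h5).trans ?_
    gcongr
    exact hp.1.le
  have hswap : ∫ ω, (∫ s in (t : ℝ)..u, K s ω) ∂P = ∫ s in (t : ℝ)..u, ∫ ω, K s ω ∂P := by
    simp_rw [intervalIntegral.integral_of_le htu']
    exact (integral_integral_swap hKi).symm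
  have hJ : Integrable (fun ω => ∫ s in (t : ℝ)..u, K s ω) P := by
    simp_rw [intervalIntegral.integral_of_le htu']
    exact hKi.integral_prod_right
  -- The factor `exp (c (u - s))` cancels the probability that `y` stays put from `s` to `u`. What
  -- remains is the density of the time of the jump from `q` to `q + 1`.
  have hKs : ∀ s ∈ uIcc (t : ℝ) u, ∫ ω, K s ω ∂P =
      c * (Real.exp (-(c * (s - t))) * (c * (s - t)) ^ q / (q.factorial : ℝ)) := by
    intro s hs
    rw [uIcc_of_le htu'] at hs
    have hs0 : 0 ≤ s := t.2.trans hs.1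
    have h1 : t ≤ s.toNNReal := NNReal.le_toNNReal_of_coe_le hs.1
    have h2 : s.toNNReal ≤ u := Real.toNNReal_le_iff_le_coe.2 hs.2
    have h3 : ∫ ω, (if y s.toNNReal ω - y t ω = q then (1 : ℝ) else 0) *
        (if y u ω - y t ω = q then 1 else 0) ∂P =
        P.real {ω | y s.toNNReal ω - y t ω = q ∧ y u ω - y t ω = q} := by
      have hms : MeasurableSet {ω | y s.toNNReal ω - y t ω = (q : ℤ) ∧ y u ω - y t ω = (q : ℤ)} :=
        (measurableSet_eq_fun (hsm _) measurable_const).inter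
          (measurableSet_eq_fun (hsm _) measurable_const)
      rw [← integral_indicator_one hms]
      congr 1 with ω
      by_cases a : y s.toNNReal ω - y t ω = q <;> by_cases b : y u ω - y t ω = q <;>
        simp [indicator, a, b]
    simp only [hK]
    rw [integral_const_mul, h3, hy.measureReal_stay h1 h2, hy.measureReal_sub_eq h1,
      Real.coe_toNNReal s hs0]
    have : Real.exp (c * (u - s)) * Real.exp (-(c * (u - s))) = 1 := by
      rw [← Real.exp_add]; simp
    linear_combination (c : ℝ) * (Real.exp (-(c * (s - t))) * (c * (s - t)) ^ q /
      (q.factorial : ℝ)) * this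
  have hpath : ∀ᵐ ω ∂P, (if y u ω - y t ω ≤ q then Real.exp (c * ∫ s in (t : ℝ)..u,
      if y s.toNNReal ω - y t ω = q then 1 else 0) else 0) =
      (if y u ω - y t ω ≤ q then 1 else 0) + ∫ s in (t : ℝ)..u, K s ω := by
    filter_upwards [hy.path] with ω hω
    have hg : Monotone (fun s : ℝ => y s.toNNReal ω - y t ω) := fun a b hab => by
      have := hω.mono (Real.toNNReal_le_toNNReal hab)
      simp only at this ⊢
      omega
    have := exp_occupation_eq hg htu' q c
    simpa [hK] using this
  rw [integral_congr_ae hpath, integral_add hI hJ, hswap, intervalIntegral.integral_congr hKs,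
    integral_poisson_density, ← hy.measureReal_sub_le htu]
  have hms : MeasurableSet {ω | y u ω - y t ω ≤ (q : ℤ)} :=
    measurableSet_le (hsm _) measurable_const
  have : ∫ ω, (if y u ω - y t ω ≤ q then (1 : ℝ) else 0) ∂P =
      P.real {ω | y u ω - y t ω ≤ (q : ℤ)} := by
    rw [← integral_indicator_one hms]
    congr 1 with ω
    by_cases a : y u ω - y t ω ≤ q <;>
      simp only [indicator, mem_ofPred_eq, a, if_true, if_false, Pi.one_apply]
  rw [this]
  ring

end PoissonComputation

/-! ### Probability that the upper walk stays put. -/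

section VoidProbability

variable {Ω : Type*} [MeasurableSpace Ω] {P : Measure Ω} [IsProbabilityMeasure P] {α₀ α₁ : ℝ≥0}
  {x y : ℝ≥0 → Ω → ℤ}

/-- The normalized weight of the trajectories of `Y` during `(t, u]` that do not go up by more
than `q`. -/
noncomputable def occWeight (c : ℝ≥0) (Y : ℝ≥0 → Ω → ℤ) (t u : ℝ≥0) (q : ℕ) (ω : Ω) : ℝ :=
  if Y u ω - Y t ω ≤ q then Real.exp (c * ∫ s in (t : ℝ)..u,
    if Y s.toNNReal ω - Y t ω = q then 1 else 0) else 0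

omit [IsProbabilityMeasure P] in
lemma aestronglyMeasurable_occWeight {c : ℝ≥0} (hy : IsPoissonWalk c y P) {t u : ℝ≥0}
    (htu : t ≤ u) (q : ℕ) : AEStronglyMeasurable[futureInc y t] (occWeight c y t u q) P := by
  have h := aestronglyMeasurable_intervalIntegral_of_rightCts (m := futureInc y t) (P := P)
    (Z := fun s ω => y s ω - y t ω) htu (fun s hs => measurable_futureInc y hs.1) (by
        filter_upwards [hy.path] with ω hω s
        filter_upwards [hω.rightCts s] with r hr
        rw [hr]) (h := fun k => if k = q then 1 else 0) (C := 1) (fun k => abs_ite_one_le _)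
  have h1 : AEStronglyMeasurable[futureInc y t] (fun ω => Real.exp (c * ∫ s in (t : ℝ)..u,
      if y s.toNNReal ω - y t ω = q then 1 else 0)) P :=
    Real.continuous_exp.comp_aestronglyMeasurable (h.const_mul (c : ℝ))
  have h2 : StronglyMeasurable[futureInc y t]
      (fun ω => if y u ω - y t ω ≤ q then (1 : ℝ) else 0) :=
    ((measurable_of_countable (fun k : ℤ => if k ≤ q then (1 : ℝ) else 0)).comp
      (measurable_futureInc y htu)).stronglyMeasurable
  refine (h1.mul h2.aestronglyMeasurable).congr (.of_forall fun ω => ?_)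
  simp [occWeight]

omit [MeasurableSpace Ω] in
lemma occWeight_nonneg (c : ℝ≥0) (Y : ℝ≥0 → Ω → ℤ) (t u : ℝ≥0) (q : ℕ) (ω : Ω) :
    0 ≤ occWeight c Y t u q ω := by
  unfold occWeight
  split_ifs <;> positivity

omit [MeasurableSpace Ω] in
lemma occWeight_le (c : ℝ≥0) (Y : ℝ≥0 → Ω → ℤ) {t u : ℝ≥0} (htu : t ≤ u) (q : ℕ) (ω : Ω) :
    occWeight c Y t u q ω ≤ Real.exp (c * (u - t)) := by
  unfold occWeight
  split_ifs
  · gcongr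
    have htu' : (t : ℝ) ≤ u := htu
    have h := intervalIntegral.norm_integral_le_of_norm_le_const (a := (t : ℝ)) (b := u) (C := 1)
      (f := fun s => if Y s.toNNReal ω - Y t ω = q then (1 : ℝ) else 0)
      (fun s _ => abs_ite_one_le _)
    rw [one_mul, abs_of_nonneg (by linarith)] at h
    exact (le_abs_self _).trans h
  · positivity

/-- The future of `Y` is independent of the past of `X` and `Y`. -/
lemma IsChamberWalk.integral_occWeight_mul (hα : α₁ < α₀) (hy : IsPoissonWalk α₁ y P)
    (hx : IsChamberWalk α₀ α₁ x y P) {t u : ℝ≥0} (htu : t ≤ u) (q : ℕ)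
    (S : Finset ℝ≥0) (hS : ∀ s ∈ S, s ≤ t) {Φ : Ω → ℝ}
    (hΦ : Measurable[pastInc y t ⊔ ⨆ s ∈ S, MeasurableSpace.comap (x s) inferInstance] Φ)
    (hΦ1 : ∀ ω, |Φ ω| ≤ 1) :
    ∫ ω, occWeight α₁ y t u q ω * Φ ω ∂P = ∫ ω, Φ ω ∂P := by
  set C := Real.exp (α₁ * (u - t))
  have hC0 : 0 < C := Real.exp_pos _
  obtain ⟨w₀, hw₀, he₀⟩ := aestronglyMeasurable_occWeight hy htu q
  -- A version of the weight that is measurable for the future increments; clamping makes its bounds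
  -- hold everywhere.
  set w : Ω → ℝ := fun ω => max 0 (min C (w₀ ω)) with hw
  have hwm : Measurable[futureInc y t] w :=
    measurable_const.max (measurable_const.min hw₀.measurable)
  have hwC : ∀ ω, |w ω| ≤ C := fun ω => by
    rw [abs_of_nonneg (le_max_left _ _)]
    exact max_le hC0.le (min_le_left _ _)
  have he : occWeight α₁ y t u q =ᵐ[P] w := by
    filter_upwards [he₀] with ω hω
    rw [hw]
    simp only
    rw [← hω, min_eq_right (occWeight_le α₁ y htu q ω),
      max_eq_right (occWeight_nonneg α₁ y t u q ω)]
  have hfut := futureInc_le hy.measurable t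
  have hw1 : ∫ ω, w ω ∂P = 1 := by
    rw [← integral_congr_ae he]
    exact hy.integral_exp_occupation htu q
  have hwi : Integrable w P :=
    ae_abs_le_integrable (hwm.mono hfut le_rfl).aestronglyMeasurable (.of_forall hwC)
  -- The weight minus its mean `1`, scaled so that `|v| ≤ 1`: a centred functional of the future,
  -- hence uncorrelated with the past of `y`.
  set v : Ω → ℝ := fun ω => (C + 1)⁻¹ * (w ω - 1) with hv
  have hvm : Measurable[futureInc y t] v := measurable_const.mul (hwm.sub measurable_const)
  have hv1 : ∀ ω, |v ω| ≤ 1 := fun ω => by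
    rw [hv, abs_mul, abs_of_pos (by positivity), inv_mul_le_iff₀ (by positivity), mul_one]
    refine (abs_sub _ _).trans ?_
    rw [abs_one]
    linarith [hwC ω]
  have hvE : ∫ ω, v ω ∂P = 0 := by
    rw [integral_const_mul, integral_sub hwi (integrable_const _), hw1]
    simp
  have hv0 : ∀ Ψ : Ω → ℝ, Measurable[pastInc y t] Ψ → (∀ ω, |Ψ ω| ≤ 1) →
      ∫ ω, v ω * Ψ ω ∂P = 0 := by
    intro Ψ hΨ _
    have hind : v ⟂ᵢ[P] Ψ := by
      rw [IndepFun_iff_Indep]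
      exact indep_of_indep_of_le_left (indep_of_indep_of_le_right
        (hy.indep.indep_futureInc_pastInc hy.measurable t) hΨ.comap_le) hvm.comap_le
    rw [hind.integral_fun_mul_eq_mul_integral (hvm.mono hfut le_rfl).aestronglyMeasurable
      (hΨ.mono (pastInc_le hy.measurable t) le_rfl).aestronglyMeasurable, hvE, zero_mul]
  have hall : futureInc y t ≤ ⨆ s, MeasurableSpace.comap (y s) inferInstance := by
    refine futureInc_le (fun s => ?_) t
    exact Measurable.of_comap_le (le_iSup (fun s => MeasurableSpace.comap (y s) inferInstance) s)
  have key := hx.integral_mul_eq_zero hα hy (hvm.mono hall le_rfl) hv1 hv0 S hS hΦ hΦ1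
  have hΦm : Measurable Φ := hΦ.mono (sup_le (pastInc_le hy.measurable t)
    (iSup₂_le fun s _ => (hx.measurable s).comap_le)) le_rfl
  have hΦi : Integrable Φ P := ae_abs_le_integrable hΦm.aestronglyMeasurable (.of_forall hΦ1)
  have hwΦ : Integrable (fun ω => w ω * Φ ω) P := by
    refine ae_abs_le_integrable (C := C * 1)
      ((hwm.mono hfut le_rfl).mul hΦm).aestronglyMeasurable (.of_forall fun ω => ?_)
    rw [abs_mul]
    exact mul_le_mul (hwC ω) (hΦ1 ω) (abs_nonneg _) hC0.le
  have e1 : ∫ ω, v ω * Φ ω ∂P = (C + 1)⁻¹ * (∫ ω, w ω * Φ ω ∂P - ∫ ω, Φ ω ∂P) := by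
    rw [← integral_sub hwΦ hΦi, ← integral_const_mul]
    congr 1 with ω
    simp only [hv]
    ring
  rw [e1, mul_eq_zero, inv_eq_zero] at key
  have h2 : ∫ ω, w ω * Φ ω ∂P = ∫ ω, Φ ω ∂P := by
    rcases key with h | h <;> linarith
  rw [← h2]
  refine integral_congr_ae ?_
  filter_upwards [he] with ω hω
  rw [hω]

omit [IsProbabilityMeasure P] in
/-- As long as `X` stays at `a`, its clock only depends on the time that `Y` spends at `a`. -/
lemma clockProb_eq_occWeight {r : ℝ≥0} (hy : IsPoissonWalk r y P) {t u : ℝ≥0} (htu : t ≤ u) :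
    ∀ᵐ ω ∂P, ∀ a b : ℤ, b ≤ a → y t ω = b →
      clockProb α₀ α₁ y t u a ω * (if y u ω ≤ a then 1 else 0) =
        Real.exp (-(α₀ * (u - t))) * occWeight α₁ y t u (a - b).toNat ω := by
  have htu' : (t : ℝ) ≤ u := htu
  filter_upwards [hy.path] with ω hω a b hba hb
  have hq : ((a - b).toNat : ℤ) = a - b := Int.toNat_of_nonneg (by omega)
  unfold occWeight clockProb
  rw [hq, hb]
  by_cases h : y u ω ≤ a
  · have h' : y u ω - b ≤ a - b := by omega
    rw [if_pos h, if_pos h', mul_one, ← Real.exp_add]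
    congr 1
    have hrate : ∀ s ∈ uIcc (t : ℝ) u,
        chamberRate α₀ α₁ (max a (y s.toNNReal ω)) (y s.toNNReal ω) =
          α₀ - α₁ * (if y s.toNNReal ω - b = a - b then 1 else 0) := by
      intro s hs
      rw [uIcc_of_le htu'] at hs
      have : y s.toNNReal ω ≤ y u ω := hω.mono (Real.toNNReal_le_iff_le_coe.2 hs.2)
      rw [max_eq_left (this.trans h), chamberRate]
      by_cases hc : y s.toNNReal ω = a
      · simp [hc]
      · have h1 : ¬ a = y s.toNNReal ω := fun e => hc e.symm
        have h2 : ¬ y s.toNNReal ω - b = a - b := by omega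
        rw [if_neg h1, if_neg h2]
        simp
    have hm : Measurable (fun s : ℝ => if y s.toNNReal ω - b = a - b then (1 : ℝ) else 0) := by
      have hmono : Monotone (fun s : ℝ => y s.toNNReal ω) := fun _ _ h =>
        hω.mono (Real.toNNReal_le_toNNReal h)
      exact (measurable_of_countable
        (fun k : ℤ => if k - b = a - b then (1 : ℝ) else 0)).comp hmono.measurable
    have hii : IntervalIntegrable
        (fun s : ℝ => if y s.toNNReal ω - b = a - b then (1 : ℝ) else 0) volume t u := by
      refine (intervalIntegrable_const (c := (1 : ℝ))).mono_fun hm.aestronglyMeasurable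
        (.of_forall fun s => ?_)
      rw [norm_one]
      exact abs_ite_one_le _
    rw [intervalIntegral.integral_congr hrate, intervalIntegral.integral_sub
      intervalIntegrable_const (hii.const_mul _), intervalIntegral.integral_const,
      intervalIntegral.integral_const_mul, smul_eq_mul]
    ring
  · have h' : ¬ y u ω - b ≤ a - b := by omega
    rw [if_neg h, if_neg h']
    simp

omit [IsProbabilityMeasure P] in
lemma IsChamberWalk.stay_ae_eq (hx : IsChamberWalk α₀ α₁ x y P) {r : ℝ≥0}
    (hy : IsPoissonWalk r y P) {t u : ℝ≥0} (htu : t ≤ u) :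
    ∀ᵐ ω ∂P, x u ω = x t ω ↔ ω ∈ noOwnJump x y t u ∧ y u ω ≤ x t ω := by
  filter_upwards [hx.path, hx.chamber, hy.path] with ω h1 h2 h3
  constructor
  · intro h
    have hu := h2 u
    refine ⟨fun s hs => ?_, h ▸ hu⟩
    have e : x s ω = x t ω := le_antisymm (h ▸ h1.mono hs.2) (h1.mono hs.1.le)
    have := h2 s
    rw [e] at this ⊢
    rw [max_eq_left this]
  · rintro ⟨h, h'⟩
    -- For `t = u` the event `noOwnJump` is vacuous and says nothing about `x u`.
    rcases htu.eq_or_lt with rfl | htu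
    · rfl
    · rw [h u ⟨htu, le_rfl⟩, max_eq_left h']

/-- The information about the increments of `Y` up to time `t` and `X` at the times in `S`. -/
@[reducible] def pairInfo {Ω : Type*} (X Y : ℝ≥0 → Ω → ℤ) (t : ℝ≥0) (S : Finset ℝ≥0) :
    MeasurableSpace Ω :=
  pastInc Y t ⊔ ⨆ s ∈ S, MeasurableSpace.comap (X s) inferInstance

/-- Given the past, the walk does not move for a time `u - t` with probability
`exp (-α₀ (u - t))`, here on the event that its position and that of the wall are given. -/
lemma IsChamberWalk.measureReal_inter_stay_fiber (hα : α₁ < α₀) (hy : IsPoissonWalk α₁ y P)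
    (hx : IsChamberWalk α₀ α₁ x y P) {t u : ℝ≥0} (htu : t ≤ u)
    (S : Finset ℝ≥0) (hS : ∀ s ∈ S, s ≤ t) {A : Set Ω}
    (hA : MeasurableSet[⨆ s ∈ S, MeasurableSpace.comap (x s) inferInstance] A) (a b : ℤ) :
    P.real (A ∩ {ω | x t ω = a ∧ y t ω - y 0 ω = b} ∩ {ω | x u ω = x t ω}) =
      Real.exp (-(α₀ * (u - t))) * P.real (A ∩ {ω | x t ω = a ∧ y t ω - y 0 ω = b}) := by
  classical
  set D : Set Ω := A ∩ {ω | x t ω = a ∧ y t ω - y 0 ω = b} with hD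
  rcases lt_or_ge a b with hab | hba
  -- Positions below the wall are excluded by the chamber condition; otherwise `(a - b).toNat` would
  -- not be the gap.
  · have : P D = 0 := by
      refine measure_eq_zero_iff_ae_notMem.2 ?_
      filter_upwards [hx.chamber, hy.path] with ω h1 h2 h3
      have h4 := h1 t
      have h5 : y 0 ω = 0 := h2.zero
      have h6 := h3.2
      simp only [mem_ofPred_eq] at h6
      omega
    simp [Measure.real, this, measure_mono_null inter_subset_left this]
  have hmC : pairInfo x y t (insert t S) ≤ chamberInfo x y t := by
    refine sup_le (pastInc_le_chamberInfo x y t t) (iSup₂_le fun s hs => ?_)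
    refine (measurable_chamberInfo_right x y ?_).comap_le
    rcases Finset.mem_insert.1 hs with rfl | h
    · exact le_rfl
    · exact hS s h
  have hmΩ := hmC.trans (chamberInfo_le hx.measurable hy.measurable t)
  have hDm : MeasurableSet[pairInfo x y t (insert t S)] D := by
    have h1 : MeasurableSet[pairInfo x y t (insert t S)] A := by
      refine (iSup₂_le fun s hs => ?_ : (⨆ s ∈ S, MeasurableSpace.comap (x s) inferInstance) ≤
          pairInfo x y t (insert t S)) A hA
      exact le_sup_of_le_right (le_iSup₂ (f := fun s (_ : s ∈ insert t S) =>
        MeasurableSpace.comap (x s) inferInstance) s (Finset.mem_insert_of_mem hs))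
    have h2 : Measurable[pairInfo x y t (insert t S)] (x t) := Measurable.of_comap_le (le_sup_of_le_right
      (le_iSup₂ (f := fun s (_ : s ∈ insert t S) =>
        MeasurableSpace.comap (x s) inferInstance) t (Finset.mem_insert_self t S)))
    have h3 : Measurable[pairInfo x y t (insert t S)] (fun ω => y t ω - y 0 ω) :=
      (measurable_pastInc y le_rfl).mono le_sup_left le_rfl
    exact h1.inter ((h2 (measurableSet_singleton a)).inter (h3 (measurableSet_singleton b)))
  set Φ : Ω → ℝ := D.indicator (fun _ => 1) with hΦ
  have hΦm : Measurable[pairInfo x y t (insert t S)] Φ := measurable_const.indicator hDm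
  have hΦ1 : ∀ ω, |Φ ω| ≤ 1 := fun ω => by
    simp only [hΦ, indicator]
    split_ifs <;> simp
  set Z : Ω → ℝ := fun ω => (if y u ω ≤ a then 1 else 0) * Φ ω with hZ
  have hZm : Measurable[chamberInfo x y t] Z := by
    refine Measurable.mul ?_ (hΦm.mono hmC le_rfl)
    exact (measurable_of_countable (fun k : ℤ => if k ≤ a then (1 : ℝ) else 0)).comp
      (measurable_chamberInfo_left x y t u)
  have hZ1 : ∀ ω, |Z ω| ≤ 1 := fun ω => abs_mul_le_one (abs_ite_one_le _) (hΦ1 ω)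
  have hE : MeasurableSet {ω | x u ω = x t ω} :=
    measurableSet_eq_fun (hx.measurable u) (hx.measurable t)
  have e1 : P.real (D ∩ {ω | x u ω = x t ω}) =
      ∫ ω, (noOwnJump x y t u).indicator (fun _ => (1 : ℝ)) ω * Z ω ∂P := by
    rw [← integral_indicator_one ((hmΩ D hDm).inter hE)]
    refine integral_congr_ae ?_
    filter_upwards [hx.stay_ae_eq hy htu] with ω hω
    simp only [hZ, hΦ]
    by_cases hd : ω ∈ D
    · have hxa : x t ω = a := hd.2.1
      by_cases hs : x u ω = x t ω
      · have h1 := hω.1 hs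
        have hmem : ω ∈ D ∩ {ω | x u ω = x t ω} := ⟨hd, hs⟩
        rw [indicator_of_mem hmem, indicator_of_mem h1.1, indicator_of_mem hd,
          if_pos (hxa ▸ h1.2)]
        simp
      · have hmem : ω ∉ D ∩ {ω | x u ω = x t ω} := fun h => hs h.2
        rw [indicator_of_notMem hmem, indicator_of_mem hd]
        by_cases hN : ω ∈ noOwnJump x y t u
        · have : ¬ y u ω ≤ a := fun h => hs (hω.2 ⟨hN, hxa.symm ▸ h⟩)
          simp [this]
        · simp [hN]
    · have hmem : ω ∉ D ∩ {ω | x u ω = x t ω} := fun h => hd h.1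
      rw [indicator_of_notMem hmem, indicator_of_notMem hd]
      simp
  have e2 : P.real D = ∫ ω, Φ ω ∂P := by
    rw [hΦ, integral_indicator (hmΩ D hDm), setIntegral_const, smul_eq_mul, mul_one]
  have hS' : ∀ s ∈ insert t S, s ≤ t := fun s hs => by
    rcases Finset.mem_insert.1 hs with rfl | h
    · exact le_rfl
    · exact hS s h
  -- First the clock is averaged given all of `y`, then the resulting weight is averaged over the
  -- future of `y`, where it contributes `1`.
  rw [e1, hx.integral_noOwnJump_mul hy.measurable htu hZm hZ1, e2,
    ← hx.integral_occWeight_mul hα hy htu (a - b).toNat (insert t S) hS' hΦm hΦ1,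
    ← integral_const_mul]
  refine integral_congr_ae ?_
  filter_upwards [clockProb_eq_occWeight (α₀ := α₀) (α₁ := α₁) hy htu, hy.path] with ω h1 h2
  by_cases hd : ω ∈ D
  · have hxa : x t ω = a := hd.2.1
    have hyb : y t ω = b := by
      have h3 : y t ω - y 0 ω = b := hd.2.2
      have h4 : y 0 ω = 0 := h2.zero
      omega
    simp only [hZ]
    rw [hxa, ← mul_assoc, h1 a b hba hyb]
    ring
  · simp [hZ, hΦ, hd]

/-- The constant does not depend on the fiber, so the countably many positions of walk and wall can
be summed out. -/
lemma measure_eq_mul_of_fibers {ι : Type*} [Countable ι] [MeasurableSpace ι]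
    [MeasurableSingletonClass ι] {f : Ω → ι} (hf : Measurable f) {A E : Set Ω}
    (hA : MeasurableSet A) (hE : MeasurableSet E) {c : ℝ} (hc : 0 ≤ c)
    (h : ∀ i, P.real (A ∩ f ⁻¹' {i} ∩ E) = c * P.real (A ∩ f ⁻¹' {i})) :
    P (A ∩ E) = ENNReal.ofReal c * P A := by
  have hsum : ∀ B : Set Ω, MeasurableSet B → P B = ∑' i, P (B ∩ f ⁻¹' {i}) := fun B hB => by
    rw [← measure_iUnion]
    · congr 1
      ext ω
      simp
    · intro i j hij
      refine Set.disjoint_left.2 fun ω h1 h2 => hij ?_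
      exact h1.2.symm.trans h2.2
    · exact fun i => hB.inter (hf (measurableSet_singleton i))
  rw [hsum _ (hA.inter hE), hsum A hA, ← ENNReal.tsum_mul_left]
  congr 1 with i
  have e : A ∩ E ∩ f ⁻¹' {i} = A ∩ f ⁻¹' {i} ∩ E := inter_right_comm _ _ _
  rw [e, ← ofReal_measureReal, h, ENNReal.ofReal_mul hc, ofReal_measureReal]

/-- The information about `X` up to time `t`. -/
@[reducible] def pastInfo {Ω : Type*} (X : ℝ≥0 → Ω → ℤ) (t : ℝ≥0) : MeasurableSpace Ω :=
  ⨆ s : Iic t, MeasurableSpace.comap (X s) inferInstance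

/-- The walk does not move during `(t, u]` with probability `exp (-α₀ (u - t))`, independently
of its past. -/
theorem IsChamberWalk.stay_indep (hα : α₁ < α₀) (hy : IsPoissonWalk α₁ y P)
    (hx : IsChamberWalk α₀ α₁ x y P) {t u : ℝ≥0} (htu : t ≤ u) :
    P.real {ω | x u ω = x t ω} = Real.exp (-(α₀ * (u - t))) ∧
      Indep (pastInfo x t) (MeasurableSpace.generateFrom {{ω | x u ω = x t ω}}) P := by
  classical
  have hE : MeasurableSet {ω | x u ω = x t ω} :=
    measurableSet_eq_fun (hx.measurable u) (hx.measurable t)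
  have hgen : MeasurableSpace.generateFrom {{ω | x u ω = x t ω}} ≤ ‹MeasurableSpace Ω› :=
    MeasurableSpace.generateFrom_le fun s hs => by rw [mem_singleton_iff.1 hs]; exact hE
  have hle : ∀ S : Finset (Iic t),
      (⨆ s ∈ S, MeasurableSpace.comap (x s) inferInstance) ≤ ‹MeasurableSpace Ω› :=
    fun S => iSup₂_le fun s _ => (hx.measurable s).comap_le
  have key : ∀ (S : Finset (Iic t)) (A : Set Ω),
      MeasurableSet[⨆ s ∈ S, MeasurableSpace.comap (x s) inferInstance] A →
      P (A ∩ {ω | x u ω = x t ω}) = ENNReal.ofReal (Real.exp (-(α₀ * (u - t)))) * P A := by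
    intro S A hA
    have hA' : MeasurableSet[⨆ s ∈ S.image Subtype.val,
        MeasurableSpace.comap (x s) inferInstance] A := by
      refine (iSup₂_le fun s hs => ?_ : (⨆ s ∈ S, MeasurableSpace.comap (x s) inferInstance) ≤
        ⨆ s ∈ S.image Subtype.val, MeasurableSpace.comap (x s) inferInstance) A hA
      exact le_iSup₂ (f := fun s (_ : s ∈ S.image Subtype.val) =>
        MeasurableSpace.comap (x s) inferInstance) (s : ℝ≥0) (Finset.mem_image_of_mem _ hs)
    refine measure_eq_mul_of_fibers (f := fun ω => (x t ω, y t ω - y 0 ω))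
      ((hx.measurable t).prodMk ((hy.measurable t).sub (hy.measurable 0))) (hle S A hA) hE
      (Real.exp_pos _).le fun i => ?_
    have e : (fun ω => (x t ω, y t ω - y 0 ω)) ⁻¹' {i} =
        {ω | x t ω = i.1 ∧ y t ω - y 0 ω = i.2} := by
      ext ω
      simp [Prod.ext_iff]
    rw [e]
    refine hx.measureReal_inter_stay_fiber hα hy htu _ (fun s hs => ?_) hA' i.1 i.2
    obtain ⟨r, -, rfl⟩ := Finset.mem_image.1 hs
    exact r.2
  have hP : P {ω | x u ω = x t ω} = ENNReal.ofReal (Real.exp (-(α₀ * (u - t)))) := by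
    have := key ∅ univ MeasurableSet.univ
    simpa using this
  refine ⟨by rw [Measure.real, hP, ENNReal.toReal_ofReal (Real.exp_pos _).le], ?_⟩
  rw [pastInfo, iSup_eq_iSup_finset]
  refine indep_iSup_of_directed_le (fun S => ?_) hle hgen (directed_finset_iSup _)
  refine IndepSets.indep (hle S) hgen
    (p1 := {A | MeasurableSet[⨆ s ∈ S, MeasurableSpace.comap (x s) inferInstance] A})
    (@MeasurableSpace.isPiSystem_measurableSet Ω
      (⨆ s ∈ S, MeasurableSpace.comap (x s) inferInstance)) (IsPiSystem.singleton _)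
    (@MeasurableSpace.generateFrom_measurableSet Ω
      (⨆ s ∈ S, MeasurableSpace.comap (x s) inferInstance)).symm rfl ?_
  rw [IndepSets_iff]
  intro A B hA hB
  rw [mem_singleton_iff.1 hB, key S A hA, hP, mul_comm]

end VoidProbability

/-! ### From memoryless waiting times to a Poisson walk. -/

section PoissonOfVoid

variable {Ω : Type*}

lemma measurable_pastInfo (X : ℝ≥0 → Ω → ℤ) {s t : ℝ≥0} (h : s ≤ t) :
    Measurable[pastInfo X t] (X s) :=
  Measurable.of_comap_le
    (le_iSup (fun s : Iic t => MeasurableSpace.comap (X s) inferInstance) ⟨s, h⟩)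

lemma pastInfo_le [m : MeasurableSpace Ω] {X : ℝ≥0 → Ω → ℤ} (hX : ∀ t, Measurable (X t))
    (t : ℝ≥0) : pastInfo X t ≤ m :=
  iSup_le fun s => (hX s).comap_le

lemma pastInfo_mono (X : ℝ≥0 → Ω → ℤ) {s t : ℝ≥0} (h : s ≤ t) : pastInfo X s ≤ pastInfo X t :=
  iSup_le fun r => (measurable_pastInfo X (r.2.trans h)).comap_le

/-- The `k`-th point of the regular subdivision of `[t, u]` into `n` pieces. -/
noncomputable def subdivision (t u : ℝ≥0) (n k : ℕ) : ℝ≥0 := t + k * ((u - t) / n)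

lemma subdivision_zero (t u : ℝ≥0) (n : ℕ) : subdivision t u n 0 = t := by simp [subdivision]

lemma subdivision_self {t u : ℝ≥0} (htu : t ≤ u) {n : ℕ} (hn : n ≠ 0) :
    subdivision t u n n = u := by
  rw [subdivision, mul_div_cancel₀ _ (by exact_mod_cast hn), add_tsub_cancel_of_le htu]

lemma subdivision_mono (t u : ℝ≥0) (n : ℕ) : Monotone (subdivision t u n) := fun a b h => by
  unfold subdivision
  gcongr

lemma subdivision_sub {t u : ℝ≥0} (htu : t ≤ u) (n k : ℕ) :
    (subdivision t u n (k + 1) : ℝ) - subdivision t u n k = (u - t) / n := by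
  unfold subdivision
  push_cast [NNReal.coe_sub htu]
  ring

/-- The product over the first `k` pieces of the subdivision of `[t, u]` of the factor `z` for each
piece in which `X` moves. -/
noncomputable def moveProd (X : ℝ≥0 → Ω → ℤ) (t u : ℝ≥0) (n : ℕ) (z : ℂ) (k : ℕ) (ω : Ω) : ℂ :=
  ∏ i ∈ Finset.range k,
    if X (subdivision t u n (i + 1)) ω = X (subdivision t u n i) ω then 1 else z

lemma measurable_moveProd (X : ℝ≥0 → Ω → ℤ) (t u : ℝ≥0) (n : ℕ) (z : ℂ) (k : ℕ) :
    Measurable[pastInfo X (subdivision t u n k)] (moveProd X t u n z k) := by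
  refine Finset.measurable_fun_prod _ fun i hi => ?_
  have hi' := Finset.mem_range.1 hi
  have h1 : Measurable[pastInfo X (subdivision t u n k)] (X (subdivision t u n (i + 1))) :=
    measurable_pastInfo X (subdivision_mono t u n hi')
  have h2 : Measurable[pastInfo X (subdivision t u n k)] (X (subdivision t u n i)) :=
    measurable_pastInfo X (subdivision_mono t u n hi'.le)
  exact (measurable_of_countable (fun p : ℤ × ℤ => if p.1 = p.2 then (1 : ℂ) else z)).comp
    (h1.prodMk h2)

lemma norm_moveProd_le (X : ℝ≥0 → Ω → ℤ) (t u : ℝ≥0) (n : ℕ) {z : ℂ} (hz : ‖z‖ = 1) (k : ℕ)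
    (ω : Ω) : ‖moveProd X t u n z k ω‖ ≤ 1 := by
  unfold moveProd
  rw [norm_prod]
  refine Finset.prod_le_one (fun _ _ => norm_nonneg _) fun i _ => ?_
  split_ifs <;> simp [hz]

lemma tendsto_nat_mul_exp_sub_one (a : ℝ) :
    Tendsto (fun n : ℕ => (n : ℝ) * (Real.exp (-(a / n)) - 1)) atTop (𝓝 (-a)) := by
  have hd : HasDerivAt (fun s : ℝ => Real.exp (-(a * s))) (-a) 0 := by
    simpa using (((hasDerivAt_id (0 : ℝ)).const_mul a).neg).exp
  have h1 := hd.tendsto_slope_zero_right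
  have h2 : Tendsto (fun n : ℕ => ((n : ℝ))⁻¹) atTop (𝓝[>] 0) :=
    tendsto_inv_atTop_nhdsGT_zero.comp tendsto_natCast_atTop_atTop
  refine (h1.comp h2).congr fun n => ?_
  simp [div_eq_mul_inv]

lemma tendsto_poisson_charFun (a : ℝ) (z : ℂ) :
    Tendsto (fun n : ℕ => (z + (1 - z) * (Real.exp (-(a / n)) : ℝ)) ^ n) atTop
      (𝓝 (Complex.exp (a * (z - 1)))) := by
  have h1 : Tendsto (fun n : ℕ => (n : ℂ) * ((1 - z) * ((Real.exp (-(a / n)) : ℝ) - 1))) atTop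
      (𝓝 (a * (z - 1))) := by
    have h2 := (Complex.continuous_ofReal.tendsto _).comp (tendsto_nat_mul_exp_sub_one a)
    have h3 := h2.const_mul (1 - z)
    have e : (1 - z) * ((-a : ℝ) : ℂ) = a * (z - 1) := by push_cast; ring
    rw [e] at h3
    refine h3.congr fun n => ?_
    simp only [Function.comp_apply]
    push_cast
    ring
  refine (Complex.tendsto_one_add_pow_exp_of_tendsto h1).congr fun n => ?_
  congr 1
  ring

/-- On a fine enough subdivision each piece carries at most one unit jump, so the number of moving
pieces is the increment. -/
lemma eventually_moveProd_eq {X : ℝ≥0 → Ω → ℤ} {ω : Ω} (hω : IsUnitStepPath (fun t => X t ω))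
    {t u : ℝ≥0} (htu : t ≤ u) (z : ℂ) :
    ∀ᶠ n : ℕ in atTop, moveProd X t u n z n ω = z ^ (X u ω - X t ω).toNat := by
  obtain ⟨δ, hδ, H⟩ := hω.exists_mesh hω u
  have h0 : Tendsto (fun n : ℕ => ((u : ℝ) - t) / n) atTop (𝓝 0) :=
    tendsto_const_div_atTop_nhds_zero_nat _
  filter_upwards [h0.eventually_lt_const hδ, eventually_ne_atTop 0] with n hn hn0
  have hle : ∀ k ≤ n, moveProd X t u n z k ω = z ^ (X (subdivision t u n k) ω - X t ω).toNat := by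
    intro k hk
    induction k with
    | zero => simp [moveProd, subdivision_zero]
    | succ k ih =>
      have hm := subdivision_mono t u n (Nat.le_succ k)
      have htop : subdivision t u n (k + 1) ≤ u :=
        (subdivision_mono t u n hk).trans_eq (subdivision_self htu hn0)
      obtain ⟨h1, -⟩ := H (subdivision t u n k) (subdivision t u n (k + 1)) hm htop
        (by rw [subdivision_sub htu]; exact hn)
      have h2 : X (subdivision t u n k) ω ≤ X (subdivision t u n (k + 1)) ω := hω.mono hm
      have h3 : X t ω ≤ X (subdivision t u n k) ω := by
        have := hω.mono (subdivision_mono t u n (Nat.zero_le k))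
        rwa [subdivision_zero] at this
      have e : moveProd X t u n z (k + 1) ω = moveProd X t u n z k ω *
          (if X (subdivision t u n (k + 1)) ω = X (subdivision t u n k) ω then 1 else z) :=
        Finset.prod_range_succ _ _
      rw [e, ih (by omega)]
      split_ifs with h
      · rw [h, mul_one]
      · rw [← pow_succ]
        congr 1
        omega
  rw [hle n le_rfl, subdivision_self htu hn0]

variable [MeasurableSpace Ω] {P : Measure Ω} [IsProbabilityMeasure P] {α : ℝ≥0}
  {X : ℝ≥0 → Ω → ℤ}

/-- The factor is `z + (1 - z)` times the indicator of staying put, which is independent of the past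
with known probability. -/
lemma integral_mul_stay (hX : ∀ t, Measurable (X t))
    (hstay : ∀ t u : ℝ≥0, t ≤ u → P.real {ω | X u ω = X t ω} = Real.exp (-(α * (u - t))) ∧
      Indep (pastInfo X t) (MeasurableSpace.generateFrom {{ω | X u ω = X t ω}}) P)
    {t u : ℝ≥0} (htu : t ≤ u) {f : Ω → ℂ} (hf : Measurable[pastInfo X t] f) (C : ℝ)
    (hC : ∀ ω, ‖f ω‖ ≤ C) (z : ℂ) :
    ∫ ω, f ω * (if X u ω = X t ω then 1 else z) ∂P =
      (z + (1 - z) * (Real.exp (-(α * (u - t))) : ℝ)) * ∫ ω, f ω ∂P := by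
  obtain ⟨hp, hi⟩ := hstay t u htu
  have hE : MeasurableSet {ω | X u ω = X t ω} := measurableSet_eq_fun (hX u) (hX t)
  have hfm : Measurable f := hf.mono (pastInfo_le hX t) le_rfl
  set I : Ω → ℂ := {ω | X u ω = X t ω}.indicator (fun _ => 1) with hI
  have hIm : Measurable I := measurable_const.indicator hE
  have hI1 : ∀ ω, ‖I ω‖ ≤ 1 := fun ω => by
    simp only [hI, indicator]
    split_ifs <;> simp
  have hind : f ⟂ᵢ[P] I := by
    rw [IndepFun_iff_Indep]
    refine indep_of_indep_of_le_left (indep_of_indep_of_le_right hi ?_) hf.comap_le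
    refine Measurable.comap_le ?_
    exact measurable_const.indicator (MeasurableSpace.measurableSet_generateFrom rfl)
  have hIE : ∫ ω, I ω ∂P = (Real.exp (-(α * (u - t))) : ℝ) := by
    rw [hI, integral_indicator hE, setIntegral_const, ← hp]
    simp
  have hfi : Integrable f P := Integrable.of_bound hfm.aestronglyMeasurable C (.of_forall hC)
  have hfI : Integrable (fun ω => f ω * I ω) P := by
    refine Integrable.of_bound (hfm.mul hIm).aestronglyMeasurable C (.of_forall fun ω => ?_)
    rw [norm_mul]
    exact (mul_le_of_le_one_right (norm_nonneg _) (hI1 ω)).trans (hC ω)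
  have e : ∀ ω, f ω * (if X u ω = X t ω then 1 else z) = z * f ω + (1 - z) * (f ω * I ω) := by
    intro ω
    by_cases h : X u ω = X t ω
    · have hmem : ω ∈ {ω | X u ω = X t ω} := h
      rw [if_pos h, hI, indicator_of_mem hmem]; ring
    · have hmem : ω ∉ {ω | X u ω = X t ω} := h
      rw [if_neg h, hI, indicator_of_notMem hmem]; ring
  simp_rw [e]
  rw [integral_add (hfi.const_mul z) (hfI.const_mul (1 - z)), integral_const_mul,
    integral_const_mul, hind.integral_fun_mul_eq_mul_integral hfm.aestronglyMeasurable
    hIm.aestronglyMeasurable, hIE]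
  ring

/-- Conditioning on the pieces from the last to the first gives an `n`-th power, and refining the
subdivision turns it into the Poisson generating function. The set `A` records independence of the
past. -/
lemma setIntegral_pow_increment (hX : ∀ t, Measurable (X t))
    (hpath : ∀ᵐ ω ∂P, IsUnitStepPath (fun t => X t ω))
    (hstay : ∀ t u : ℝ≥0, t ≤ u → P.real {ω | X u ω = X t ω} = Real.exp (-(α * (u - t))) ∧
      Indep (pastInfo X t) (MeasurableSpace.generateFrom {{ω | X u ω = X t ω}}) P)
    {t u : ℝ≥0} (htu : t ≤ u) {A : Set Ω} (hA : MeasurableSet[pastInfo X t] A) {z : ℂ}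
    (hz : ‖z‖ = 1) :
    ∫ ω, A.indicator (fun _ => (1 : ℂ)) ω * z ^ (X u ω - X t ω).toNat ∂P =
      P.real A * Complex.exp ((α * (u - t) : ℝ) * (z - 1)) := by
  have hI1 : ∀ ω, ‖A.indicator (fun _ => (1 : ℂ)) ω‖ ≤ 1 := fun ω => by
    simp only [indicator]
    split_ifs <;> simp
  have hAm := pastInfo_le hX t A hA
  have hIm : ∀ n k, Measurable[pastInfo X (subdivision t u n k)]
      (A.indicator (fun _ => (1 : ℂ))) := fun n k => by
    refine measurable_const.indicator (pastInfo_mono X ?_ A hA)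
    have := subdivision_mono t u n (Nat.zero_le k)
    rwa [subdivision_zero] at this
  have hb : ∀ n k ω, ‖A.indicator (fun _ => (1 : ℂ)) ω * moveProd X t u n z k ω‖ ≤ 1 :=
    fun n k ω => by
      rw [norm_mul]
      exact mul_le_one₀ (hI1 ω) (norm_nonneg _) (norm_moveProd_le X t u n hz k ω)
  have hmeas : ∀ n k, Measurable[pastInfo X (subdivision t u n k)]
      (fun ω => A.indicator (fun _ => (1 : ℂ)) ω * moveProd X t u n z k ω) := fun n k =>
    (hIm n k).mul (measurable_moveProd X t u n z k)
  have hn : ∀ n k : ℕ, ∫ ω, A.indicator (fun _ => (1 : ℂ)) ω * moveProd X t u n z k ω ∂P =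
      (z + (1 - z) * (Real.exp (-((α * (u - t) : ℝ) / n)) : ℝ)) ^ k * P.real A := by
    intro n k
    induction k with
    | zero =>
      simp only [moveProd, Finset.range_zero, Finset.prod_empty, mul_one, pow_zero, one_mul]
      rw [integral_indicator hAm, setIntegral_const]
      simp
    | succ k ih =>
      have e : ∀ ω, A.indicator (fun _ => (1 : ℂ)) ω * moveProd X t u n z (k + 1) ω =
          A.indicator (fun _ => (1 : ℂ)) ω * moveProd X t u n z k ω *
          (if X (subdivision t u n (k + 1)) ω = X (subdivision t u n k) ω then 1 else z) :=
        fun ω => by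
          rw [mul_assoc]
          congr 1
          exact Finset.prod_range_succ _ _
      simp_rw [e]
      rw [integral_mul_stay hX hstay (subdivision_mono t u n (Nat.le_succ k)) (hmeas n k) 1
        (hb n k) z, ih, subdivision_sub htu, pow_succ, mul_div_assoc]
      ring
  have hlim : Tendsto (fun n : ℕ => ∫ ω, A.indicator (fun _ => (1 : ℂ)) ω *
      moveProd X t u n z n ω ∂P) atTop
      (𝓝 (∫ ω, A.indicator (fun _ => (1 : ℂ)) ω * z ^ (X u ω - X t ω).toNat ∂P)) := by
    refine tendsto_integral_of_dominated_convergence (fun _ => 1)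
      (fun n => ((hmeas n n).mono (pastInfo_le hX _) le_rfl).aestronglyMeasurable)
      (integrable_const _) (fun n => .of_forall fun ω => hb n n ω) ?_
    filter_upwards [hpath] with ω hω
    refine tendsto_nhds_of_eventually_eq ?_
    filter_upwards [eventually_moveProd_eq hω htu z] with n hn
    rw [hn]
  simp_rw [hn] at hlim
  have h2 := (tendsto_poisson_charFun (α * (u - t)) z).mul_const (P.real A : ℂ)
  rw [tendsto_nhds_unique hlim h2, mul_comm]

/-- The increments of a unit step process whose waiting times are memoryless are Poisson
distributed and independent of the past. -/
lemma measure_inter_increment (hX : ∀ t, Measurable (X t))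
    (hpath : ∀ᵐ ω ∂P, IsUnitStepPath (fun t => X t ω))
    (hstay : ∀ t u : ℝ≥0, t ≤ u → P.real {ω | X u ω = X t ω} = Real.exp (-(α * (u - t))) ∧
      Indep (pastInfo X t) (MeasurableSpace.generateFrom {{ω | X u ω = X t ω}}) P)
    {t u : ℝ≥0} (htu : t ≤ u) {A : Set Ω} (hA : MeasurableSet[pastInfo X t] A) (B : Set ℤ) :
    P (A ∩ {ω | X u ω - X t ω ∈ B}) =
      P A * (poissonMeasure (α * (u - t))).map (fun n : ℕ => (n : ℤ)) B := by
  have hAm := pastInfo_le hX t A hA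
  have hD : Measurable (fun ω => X u ω - X t ω) := (hX u).sub (hX t)
  have hDR : Measurable (fun ω => ((X u ω - X t ω : ℤ) : ℝ)) :=
    (measurable_of_countable (fun k : ℤ => (k : ℝ))).comp hD
  -- Law and independence are obtained together: the increment on `A` has the Poisson law scaled by
  -- `P A`, identified by characteristic functions on `ℝ` with `z = exp (iθ)`.
  have key : (P.restrict A).map (fun ω => ((X u ω - X t ω : ℤ) : ℝ)) =
      P A • (poissonMeasure (α * (u - t))).map (Nat.cast : ℕ → ℝ) := by
    have : IsFiniteMeasure (P A • (poissonMeasure (α * (u - t))).map (Nat.cast : ℕ → ℝ)) :=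
      Measure.smul_finite _ (measure_ne_top P A)
    refine Measure.ext_of_charFun (funext fun θ => ?_)
    have h1 : charFun (P A • (poissonMeasure (α * (u - t))).map (Nat.cast : ℕ → ℝ)) θ =
        P.real A * charFun ((poissonMeasure (α * (u - t))).map (Nat.cast : ℕ → ℝ)) θ := by
      simp only [charFun_apply, integral_smul_measure, Measure.real]
      simp
    rw [h1, charFun_map_cast_poissonMeasure, charFun_apply_real,
      integral_map hDR.aemeasurable (by fun_prop)]
    have hz : ‖Complex.exp (θ * Complex.I)‖ = 1 := Complex.norm_exp_ofReal_mul_I θ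
    have h2 := setIntegral_pow_increment hX hpath hstay htu hA hz
    have h3 : ((α * (u - t) : ℝ≥0) : ℂ) = ((α * (u - t) : ℝ) : ℂ) := by
      push_cast [NNReal.coe_sub htu]
      rfl
    rw [← integral_indicator hAm]
    refine Eq.trans (integral_congr_ae ?_) (h2.trans ?_)
    · filter_upwards [hpath] with ω hω
      have hle : X t ω ≤ X u ω := hω.mono htu
      by_cases hmem : ω ∈ A
      · rw [indicator_of_mem hmem, indicator_of_mem hmem, one_mul, ← Complex.exp_nat_mul]
        congr 1
        have : ((X u ω - X t ω : ℤ) : ℂ) = (((X u ω - X t ω).toNat : ℤ) : ℂ) := by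
          rw [Int.toNat_of_nonneg (by omega)]
        rw [Complex.ofReal_intCast, this]
        push_cast
        ring
      · rw [indicator_of_notMem hmem, indicator_of_notMem hmem, zero_mul]
    · rw [← h3]
  have hB : MeasurableSet ((fun k : ℤ => (k : ℝ)) '' B) := (B.to_countable.image _).measurableSet
  have h := congrArg (fun μ : Measure ℝ => μ ((fun k : ℤ => (k : ℝ)) '' B)) key
  simp only [Measure.smul_apply, smul_eq_mul] at h
  rw [Measure.map_apply hDR hB, Measure.restrict_apply (hDR hB),
    Measure.map_apply (measurable_of_countable _) hB] at h
  rw [Measure.map_apply (measurable_of_countable _) .of_discrete]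
  have e1 : (fun ω => ((X u ω - X t ω : ℤ) : ℝ)) ⁻¹' ((fun k : ℤ => (k : ℝ)) '' B) ∩ A =
      A ∩ {ω | X u ω - X t ω ∈ B} := by
    ext ω
    constructor
    · rintro ⟨⟨k, hk, hk'⟩, h2⟩
      refine ⟨h2, ?_⟩
      have : k = X u ω - X t ω := Int.cast_injective hk'
      exact (this ▸ hk : X u ω - X t ω ∈ B)
    · rintro ⟨h1, h2⟩
      exact ⟨⟨_, h2, rfl⟩, h1⟩
  have e2 : (Nat.cast : ℕ → ℝ) ⁻¹' ((fun k : ℤ => (k : ℝ)) '' B) =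
      (fun n : ℕ => (n : ℤ)) ⁻¹' B := by
    ext n
    constructor
    · rintro ⟨k, hk, hk'⟩
      have : k = (n : ℤ) := Int.cast_injective (hk'.trans (Int.cast_natCast n).symm)
      exact (this ▸ hk : (n : ℤ) ∈ B)
    · intro h
      exact ⟨(n : ℤ), h, by simp⟩
  rw [e1, e2] at h
  exact h

/-- A unit step process whose waiting times are memoryless is a Poisson walk. -/
theorem isPoissonWalk_of_stay_indep (hX : ∀ t, Measurable (X t))
    (hpath : ∀ᵐ ω ∂P, IsUnitStepPath (fun t => X t ω))
    (hstay : ∀ t u : ℝ≥0, t ≤ u → P.real {ω | X u ω = X t ω} = Real.exp (-(α * (u - t))) ∧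
      Indep (pastInfo X t) (MeasurableSpace.generateFrom {{ω | X u ω = X t ω}}) P) :
    IsPoissonWalk α X P := by
  have hlaw : ∀ s t, s ≤ t → ∀ B : Set ℤ, P {ω | X t ω - X s ω ∈ B} =
      (poissonMeasure (α * (t - s))).map (fun n : ℕ => (n : ℤ)) B := fun s t hst B => by
    have := measure_inter_increment hX hpath hstay hst (A := univ) MeasurableSet.univ B
    simpa using this
  refine ⟨hX, hpath, ?_, fun s t hst => ⟨((hX t).sub (hX s)).aemeasurable, ?_⟩⟩
  · refine HasIndepIncrements.of_nat fun τ hτ _ => ?_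
    rw [iIndepFun_iff_measure_inter_preimage_eq_mul]
    intro S B _
    -- The latest increment is split off each time; all the others belong to its past.
    induction S using Finset.induction_on_max with
    | empty => simp
    | insert a S ha ih =>
      have haS : a ∉ S := fun h => (ha a h).false
      rw [Finset.prod_insert haS, Finset.set_biInter_insert, inter_comm, mul_comm,
        ← ih (fun i hi => .of_discrete)]
      have hpast : MeasurableSet[pastInfo X (τ a)]
          (⋂ i ∈ S, (fun ω => X (τ (i + 1)) ω - X (τ i) ω) ⁻¹' B i) := by
        refine Finset.measurableSet_biInter S fun i hi => ?_
        have h1 : Measurable[pastInfo X (τ a)] (X (τ (i + 1))) :=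
          measurable_pastInfo X (hτ (ha i hi))
        have h2 : Measurable[pastInfo X (τ a)] (X (τ i)) :=
          measurable_pastInfo X (hτ (ha i hi).le)
        exact (h1.sub h2) .of_discrete
      have hle := hτ (Nat.le_succ a)
      have h3 := measure_inter_increment hX hpath hstay hle hpast (B a)
      rw [← hlaw _ _ hle] at h3
      exact h3
  · ext B -
    have hm : Measurable (fun ω => X t ω - X s ω) := (hX t).sub (hX s)
    rw [Measure.map_apply hm .of_discrete, ← hlaw s t hst B]
    rfl

end PoissonOfVoid

theorem mainTheorem9 {Ω : Type*} [MeasurableSpace Ω] (P : Measure Ω) [IsProbabilityMeasure P]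
    (α₀ α₁ : ℝ≥0) (hα₁ : 0 < α₁) (hα : α₁ < α₀) (y₁ x₁ : ℝ≥0 → Ω → ℤ)
    (hy : IsPoissonWalk α₁ y₁ P) (hx : IsChamberWalk α₀ α₁ x₁ y₁ P) :
    IsPoissonWalk α₀ x₁ P :=
  isPoissonWalk_of_stay_indep hx.measurable hx.path fun _ _ htu => hx.stay_indep hα hy htu
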